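/- **Setting.** For $i\in\mathbb N$ let $\Sigma_i:\ \dot x_i=A_iF_i(x_i)+B_iG_i(x_i)u_i+D_iw_i$ with $x_i\in\mathbb R^{n_i}$, $u_i\in\mathbb R^{m_i}$, $w_i=(x_j)_{j\in\mathbf M_i}$. Here $\mathbf M_i\subset\mathbb N\setminus\{i\}$ is finite, $A_i,B_i,D_i$ are constant matrices, $F_i$ and $G_i$ are a vector and a matrix of polynomials (e.g. monomials), and $F_i(x_i)=\Psi_i(x_i)x_i$ for a matrix polynomial $\Psi_i$. All vector norms are Euclidean, $\|\cdot\|_2$ is the induced matrix norm, and $\preceq$ is the Loewner order. Let $X$ and $U$ be the $\ell^2$-spaces of sequences $x=(x_i)$, $u=(u_i)$. Assume that $f_i=A_iF_i$ and $g_i=B_iG_i$ are Lipschitz on every ball with a constant independent of $i$, and that the right-hand side $\mathscr F(x,u)=(f_i(x_i)+g_i(x_i)u_i+D_i(x_j)_{j\in\mathbf M_i})_i$ maps $X\times U$ into $X$. **Data.** Along one input–state trajectory of the open-loop network, sampled at $t_k=t_0+k\tau$, $k=0,\dots,T$ ($T\ge1$, $\tau>0$), let (columns $k=0,\dots,T-1$)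 $\mathbf J_i=[F_i(x_i(t_k))]_k$, $\mathbf G_i=[G_i(x_i(t_k))u_i(t_k)]_k$, $\mathbf W_i=[w_i(t_k)]_k$, $\mathbf X_i^{\mathsf d}=[(x_i(t_{k+1})-x_i(t_k))/\tau]_k$, and stack $\mathbf L_i=[\mathbf J_i;\mathbf G_i]$, $\mathbf Q_i=[\mathbf J_i;\mathbf G_i;\mathbf W_i]$. The noise $\Delta_i=[\dot x_i(t_k)]_k-\mathbf X_i^{\mathsf d}$ satisfies $\Delta_i\Delta_i^\top\preceq\Lambda_i\Lambda_i^\top$ for a given matrix $\Lambda_i$. For matrices $Y,Q$ put $$Z_i(Y,Q)=\begin{bmatrix}YY^\top-\Lambda_i\Lambda_i^\top&-YQ^\top\\-QY^\top&QQ^\top\end{bmatrix}.$$ **Design.** For every $i$ there are constants $\kappa_i,\vartheta_i>0$, a polynomial $\gamma_i\ge0$, a matrix $P_i\succ0$ and a matrix polynomial $\mathbf K_i$ such that one of the following holds, where $C_i(x_i)=[\Psi_i(x_i)P_i^{-1};\,G_i(x_i)\mathbf K_i(x_i)]$: 1. ($D_i$ unknown) $\|D_i\|_2\le\varkappa_i$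 with $\varkappa_i>0$, $\rho_i=\|\sqrt{P_i}\|_2^2\varkappa_i^2/\vartheta_i$, and for all $x_i$, with $\tilde C_i=[C_i;0]$, $$\begin{bmatrix}0&\tilde C_i(x_i)^\top\\ \tilde C_i(x_i)&0\end{bmatrix}+(\vartheta_i+\kappa_i)\begin{bmatrix}P_i^{-1}&0\\0&0\end{bmatrix}-\gamma_i(x_i)Z_i(\mathbf X_i^{\mathsf d},\mathbf Q_i)\preceq0;$$ 2. ($D_i$ known) $\rho_i=\|\sqrt{P_i}\|_2^2\|D_i\|_2^2/\vartheta_i$, and the same inequality holds for all $x_i$ with $C_i$ in place of $\tilde C_i$ and $Z_i(\mathbf X_i^{\mathsf d}-D_i\mathbf W_i,\mathbf L_i)$ in place of $Z_i(\mathbf X_i^{\mathsf d},\mathbf Q_i)$. Put $V_i(x_i)=x_i^\top P_ix_i$, $u_i=\mathbf K_i(x_i)P_ix_i$, $\underline\alpha_i=\lambda_{\min}(P_i)$, $\overline\alpha_i=\lambda_{\max}(P_i)$. Assume that the decentralized controller $K(x)=(\mathbf K_i(x_i)P_ix_i)_i$ is an admissible feedback, that is, it maps $X$ to $U$ and is Lipschitz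 on bounded balls. **Small-gain hypotheses.** There are constants with $0<\underline\zeta\le\underline\alpha_i$, $\overline\alpha_i\le\overline\zeta$, $0<\underline\kappa'\le\kappa_i$ and $\rho_i\le\overline\rho$ for all $i$. The matrix $\Theta=(\theta_{ij})$ with $\theta_{ij}=\rho_i/\underline\alpha_j$ for $j\in\mathbf M_i$ and $\theta_{ij}=0$ otherwise satisfies $\sup_j\sum_i\theta_{ij}<\infty$. The operator $\Omega=(\theta_{ij}/\kappa_i)_{i,j}$ on $\ell^1$ has spectral radius $r(\Omega)<1$. **Theorem.** For every $\varepsilon>0$ there are $\mu=(\mu_i)\in\ell^\infty$ with $\inf_i\mu_i>0$ and a constant $\kappa_\infty>0$ with $\kappa_\infty\ge(1-r(\Omega))\inf_i\kappa_i-\varepsilon$ such that $V(x)=\sum_i\mu_iV_i(x_i)$ converges on $X$ and is a control Lyapunov function under the feedback $K$: $V$ is continuous, $$(\inf_i\mu_i)(\inf_i\underline\alpha_i)\,|x|_2^2\le V(x)\le(\sup_i\mu_i)(\sup_i\overline\alpha_i)\,|x|_2^2\qquad(x\in X),$$ and for every $x\in X$ the closed loop $\dot x=\mathscr F(x,K(x))$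 has a unique maximal solution from $x$, along which the upper right-hand Dini derivative of $V$ at time $0$ is at most $-\kappa_\infty V(x)$. Moreover the closed-loop network is uniformly globally asymptotically stable (UGAS): from every $x_0\in X$ the unique maximal solution $\phi(t,x_0)$ exists for all $t\ge0$, and there is $\beta\in\mathcal{KL}$ with $|\phi(t,x_0)|_2\le\beta(|x_0|_2,t)$ for all $t\ge0$ and $x_0\in X$. -/

import Mathlib

open scoped ENNReal NNReal Topology

/-! ## Linear algebra -/

open scoped Matrix.Norms.L2Operator in
/-- The induced `2`-norm of a real matrix. -/
noncomputable def specNorm {a b : Type} [Fintype a] [Fintype b] [DecidableEq b]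
    (A : Matrix a b ℝ) : ℝ := ‖A‖

open scoped MatrixOrder Matrix.Norms.L2Operator in
/-- The positive semidefinite square root of a positive semidefinite real matrix. -/
noncomputable def matSqrt {a : Type} [Fintype a] [DecidableEq a]
    (P : Matrix a a ℝ) : Matrix a a ℝ := CFC.sqrt P

/-- The smallest eigenvalue of a symmetric real matrix. -/
noncomputable def lamMin {a : Type} [Fintype a] [DecidableEq a] (P : Matrix a a ℝ) : ℝ :=
  sInf (spectrum ℝ P)

/-- The largest eigenvalue of a symmetric real matrix. -/
noncomputable def lamMax {a : Type} [Fintype a] [DecidableEq a] (P : Matrix a a ℝ) : ℝ :=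
  sSup (spectrum ℝ P)

/-- The Loewner order: `A ≼ B` iff `B - A` is symmetric positive semidefinite. -/
def LoewnerLE {a : Type} [Fintype a] (A B : Matrix a a ℝ) : Prop := (B - A).PosSemidef

/-! ## Infinite matrices acting on `ℓ¹` -/

/-- `sup_j ∑_i |a i j| < ∞`. -/
def ColBounded (a : ℕ → ℕ → ℝ) : Prop := ⨆ j, ∑' i, ‖a i j‖ₑ < ⊤

theorem ColBounded.summable {a : ℕ → ℕ → ℝ} (h : ColBounded a) (j : ℕ) :
    Summable fun i => ‖a i j‖ := by
  have h1 : ∑' i, ‖a i j‖ₑ ≠ ⊤ :=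
    ((le_iSup (fun j => ∑' i, ‖a i j‖ₑ) j).trans_lt h).ne
  have h2 := ENNReal.summable_toReal h1
  simpa using h2

theorem ColBounded.tsum_le {a : ℕ → ℕ → ℝ} (h : ColBounded a) (j : ℕ) :
    ∑' i, ‖a i j‖ ≤ (⨆ j, ∑' i, ‖a i j‖ₑ).toReal := by
  have h1 := ENNReal.toReal_mono h.ne (le_iSup (fun j => ∑' i, ‖a i j‖ₑ) j)
  rw [ENNReal.tsum_toReal_eq (fun i => enorm_ne_top)] at h1
  simpa using h1

/-- The `j`-th column of a column-bounded infinite matrix, as an element of `ℓ¹`. -/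
noncomputable def ColBounded.col {a : ℕ → ℕ → ℝ} (h : ColBounded a) (j : ℕ) :
    lp (fun _ : ℕ => ℂ) 1 :=
  ⟨fun i => (a i j : ℂ), memℓp_gen (by simpa using h.summable j)⟩

theorem ColBounded.norm_col_le {a : ℕ → ℕ → ℝ} (h : ColBounded a) (j : ℕ) :
    ‖h.col j‖ ≤ (⨆ j, ∑' i, ‖a i j‖ₑ).toReal := by
  rw [lp.norm_eq_tsum_rpow (by simp)]
  simpa [ColBounded.col] using h.tsum_le j

theorem summable_norm_lp_one (x : lp (fun _ : ℕ => ℂ) 1) : Summable fun j => ‖x j‖ := by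
  simpa using (lp.memℓp x).summable (by simp)

theorem ColBounded.summable_smul {a : ℕ → ℕ → ℝ} (h : ColBounded a)
    (x : lp (fun _ : ℕ => ℂ) 1) : Summable fun j => x j • h.col j := by
  refine Summable.of_norm_bounded
    ((summable_norm_lp_one x).mul_right (⨆ j, ∑' i, ‖a i j‖ₑ).toReal) fun j => ?_
  rw [norm_smul]
  exact mul_le_mul_of_nonneg_left (h.norm_col_le j) (norm_nonneg _)

/-- The bounded operator `x ↦ (∑_j a i j * x j)_i` on `ℓ¹` of a column-bounded real matrix.
The spectrum of a real operator is the spectrum of its complexification, so the operator is taken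
on the complex sequence space. See `matrixOp_apply` for the coordinates. -/
noncomputable def matrixOp (a : ℕ → ℕ → ℝ) (h : ColBounded a) :
    lp (fun _ : ℕ => ℂ) 1 →L[ℂ] lp (fun _ : ℕ => ℂ) 1 :=
  LinearMap.mkContinuous
    { toFun := fun x => ∑' j, x j • h.col j
      map_add' := fun x y => by
        rw [← (h.summable_smul x).tsum_add (h.summable_smul y)]
        simp [add_smul]
      map_smul' := fun c x => by
        rw [RingHom.id_apply, ← (h.summable_smul x).tsum_const_smul c]
        simp [mul_smul] }
    (⨆ j, ∑' i, ‖a i j‖ₑ).toReal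
    (fun x => by
      have hs := (summable_norm_lp_one x).mul_left (⨆ j, ∑' i, ‖a i j‖ₑ).toReal
      have hx : ‖x‖ = ∑' j, ‖x j‖ := by
        rw [lp.norm_eq_tsum_rpow (by simp)]
        simp
      rw [hx, ← tsum_mul_left]
      refine tsum_of_norm_bounded hs.hasSum fun j => ?_
      rw [norm_smul, mul_comm]
      exact mul_le_mul_of_nonneg_right (h.norm_col_le j) (norm_nonneg _))

theorem matrixOp_apply (a : ℕ → ℕ → ℝ) (h : ColBounded a) (x : lp (fun _ : ℕ => ℂ) 1) (i : ℕ) :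
    matrixOp a h x i = ∑' j, (a i j : ℂ) * x j := by
  have h1 : matrixOp a h x = ∑' j, x j • h.col j := rfl
  have h2 := (lp.evalCLM ℂ (fun _ : ℕ => ℂ) 1 i).map_tsum (h.summable_smul x)
  rw [h1]
  refine h2.trans (tsum_congr fun j => ?_)
  change x j * (a i j : ℂ) = _
  rw [mul_comm]

/-! ## Subsystems and the infinite network -/

/-- A countable family of input-affine polynomial subsystems
`ẋ_i = A_i F_i(x_i) + B_i G_i(x_i) u_i + D_i w_i`, `w_i = (x_j)_{j ∈ nbr i}`, with `F_i` and `G_i`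
dictionaries of polynomials (in particular, of monomials), and `F_i(x_i) = Ψ_i(x_i) x_i`. -/
structure Network where
  /-- state dimensions -/
  n : ℕ → ℕ
  /-- input dimensions -/
  m : ℕ → ℕ
  /-- sizes of the dictionaries `F_i` -/
  N : ℕ → ℕ
  /-- sizes of the dictionaries `G_i` -/
  M : ℕ → ℕ
  /-- the finite set of subsystems that affect subsystem `i` -/
  nbr : ℕ → Finset ℕ
  notMem_nbr : ∀ i, i ∉ nbr i
  A : ∀ i, Matrix (Fin (n i)) (Fin (N i)) ℝ
  B : ∀ i, Matrix (Fin (n i)) (Fin (M i)) ℝ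
  D : ∀ i, Matrix (Fin (n i)) (Σ j : nbr i, Fin (n j)) ℝ
  F : ∀ i, Fin (N i) → MvPolynomial (Fin (n i)) ℝ
  G : ∀ i, Matrix (Fin (M i)) (Fin (m i)) (MvPolynomial (Fin (n i)) ℝ)
  Ψ : ∀ i, Matrix (Fin (N i)) (Fin (n i)) (MvPolynomial (Fin (n i)) ℝ)
  F_eq : ∀ i k, F i k = ∑ l, Ψ i k l * MvPolynomial.X l

namespace Network

/-- The state space `ℝ^{n_i}` with its Euclidean norm. -/
abbrev St (S : Network) (i : ℕ) : Type := EuclideanSpace ℝ (Fin (S.n i))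

/-- The input space `ℝ^{m_i}` with its Euclidean norm. -/
abbrev In (S : Network) (i : ℕ) : Type := EuclideanSpace ℝ (Fin (S.m i))

/-- The index set of the coordinates of `w_i`. -/
abbrev Adv (S : Network) (i : ℕ) : Type := Σ j : S.nbr i, Fin (S.n j)

/-- The state space `ℓ²` of the network. -/
abbrev X (S : Network) : Type := lp (fun i => S.St i) 2

/-- The input space `ℓ²` of the network. -/
abbrev U (S : Network) : Type := lp (fun i => S.In i) 2

variable (S : Network)

/-- The value of the dictionary `F_i`. -/
noncomputable def Fval (i : ℕ) (x : S.St i) : Fin (S.N i) → ℝ :=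
  fun k => MvPolynomial.eval x.ofLp (S.F i k)

/-- The value of the dictionary `G_i`. -/
noncomputable def Gval (i : ℕ) (x : S.St i) : Matrix (Fin (S.M i)) (Fin (S.m i)) ℝ :=
  (S.G i).map (MvPolynomial.eval x.ofLp)

/-- The value of the matrix polynomial `Ψ_i`. -/
noncomputable def Ψval (i : ℕ) (x : S.St i) : Matrix (Fin (S.N i)) (Fin (S.n i)) ℝ :=
  (S.Ψ i).map (MvPolynomial.eval x.ofLp)

/-- The drift `f_i(x_i) = A_i F_i(x_i)`. -/
noncomputable def f (i : ℕ) (x : S.St i) : S.St i :=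
  WithLp.toLp 2 (Matrix.mulVec (S.A i) (S.Fval i x))

/-- The control matrix `g_i(x_i) = B_i G_i(x_i)`. -/
noncomputable def g (i : ℕ) (x : S.St i) : Matrix (Fin (S.n i)) (Fin (S.m i)) ℝ :=
  S.B i * S.Gval i x

/-- `f_i(x_i) + g_i(x_i) u_i + D_i w_i`. -/
noncomputable def subField (i : ℕ) (x : S.St i) (w : S.Adv i → ℝ) (u : S.In i) : S.St i :=
  S.f i x + WithLp.toLp 2 (Matrix.mulVec (S.g i x) u.ofLp)
    + WithLp.toLp 2 (Matrix.mulVec (S.D i) w)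

/-- The interconnection constraint `w_{ij} = x_j`. -/
def adv (x : ∀ i, S.St i) (i : ℕ) : S.Adv i → ℝ := fun p => x p.1 p.2

/-- The coordinates of the right-hand side of the network. -/
noncomputable def field (x : ∀ i, S.St i) (u : ∀ i, S.In i) : ∀ i, S.St i :=
  fun i => S.subField i (x i) (S.adv x i) (u i)

/-- `f_i` and `g_i` are locally Lipschitz uniformly in `i`. -/
def UniformlyLipschitz : Prop :=
  ∀ R : ℝ, 0 < R → ∃ L : ℝ, 0 < L ∧ ∀ (i : ℕ) (x y : S.St i), ‖x‖ ≤ R → ‖y‖ ≤ R →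
    ‖S.f i x - S.f i y‖ ≤ L * ‖x - y‖ ∧ specNorm (S.g i x - S.g i y) ≤ L * ‖x - y‖

/-- The right-hand side of the network maps `X × U` to `X`, that is, the network is a control
system on the state space `X` with input space `U`. -/
def MapsIntoX : Prop :=
  ∀ (x : S.X) (u : S.U), Memℓp (S.field (fun i => x i) (fun i => u i)) 2

variable {S}

/-- The right-hand side `x ↦ f(x) + g(x) K(x)` of the closed loop, as a map `X → X`. -/
noncomputable def closedLoop (hX : S.MapsIntoX) (K : S.X → S.U) (x : S.X) : S.X :=
  ⟨S.field (fun i => x i) (fun i => K x i), hX x (K x)⟩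

/-- Admissible feedback: Lipschitz continuous on bounded balls. -/
def Admissible (K : S.X → S.U) : Prop :=
  ∀ R : ℝ, 0 < R → ∃ L : ℝ, 0 < L ∧ ∀ x y : S.X, ‖x‖ ≤ R → ‖y‖ ≤ R →
    ‖K x - K y‖ ≤ L * ‖x - y‖

end Network

/-! ## Solutions, stability, control Lyapunov functions -/

section Dynamics

variable {E : Type} [NormedAddCommGroup E] [NormedSpace ℝ E]

/-- The interval `[0, b)`, where `b` may be `∞`. -/
def lifeSpan (b : EReal) : Set ℝ := {t | 0 ≤ t ∧ (t : EReal) < b}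

/-- `ξ` solves `ξ(t) = x₀ + ∫₀ᵗ v(ξ(s)) ds` on `[0, b)`, with continuous `ξ` and integrand. -/
def IsSolution (v : E → E) (x₀ : E) (b : EReal) (ξ : ℝ → E) : Prop :=
  ContinuousOn ξ (lifeSpan b) ∧ ContinuousOn (fun s => v (ξ s)) (lifeSpan b) ∧
    ∀ t ∈ lifeSpan b, ξ t = x₀ + ∫ s in (0 : ℝ)..t, v (ξ s)

/-- `ξ` on `[0, b)` is the unique maximal solution: every solution is a restriction of it. -/
def IsMaximalSolution (v : E → E) (x₀ : E) (b : EReal) (ξ : ℝ → E) : Prop :=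
  0 < b ∧ IsSolution v x₀ b ξ ∧
    ∀ (b' : EReal) (ξ' : ℝ → E), IsSolution v x₀ b' ξ' → b' ≤ b ∧ Set.EqOn ξ' ξ (lifeSpan b')

/-- Functions of class `𝒦ℒ`. -/
def IsClassKL (β : ℝ≥0 → ℝ≥0 → ℝ≥0) : Prop :=
  (∀ s, Continuous (fun r => β r s) ∧ StrictMono (fun r => β r s) ∧ β 0 s = 0) ∧
    ∀ r, 0 < r → StrictAnti (β r) ∧ Filter.Tendsto (β r) Filter.atTop (𝓝 0)

/-- Uniform global asymptotic stability of `ẋ = v(x)`: from every initial state the unique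
maximal solution exists for all times, with a `𝒦ℒ` bound common to all initial states. -/
def IsUGAS (v : E → E) : Prop :=
  ∃ β : ℝ≥0 → ℝ≥0 → ℝ≥0, IsClassKL β ∧ ∀ x₀ : E, ∃ ξ : ℝ → E,
    IsMaximalSolution v x₀ ⊤ ξ ∧ ∀ t : ℝ≥0, ‖ξ t‖₊ ≤ β ‖x₀‖₊ t

/-- The upper right-hand Dini derivative at zero of `t ↦ V (ξ t)`. -/
noncomputable def diniAtZero (V : E → ℝ) (ξ : ℝ → E) : EReal :=
  Filter.limsup (fun s : ℝ => (((V (ξ s) - V (ξ 0)) / s : ℝ) : EReal)) (𝓝[>] 0)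

/-- `V` is a control Lyapunov function with constants `αlo`, `αhi`, `κ`, where `v` is the
right-hand side of the closed loop: quadratic bounds and decay along the unique maximal
solutions. -/
def IsCLF (v : E → E) (V : E → ℝ) (αlo αhi κ : ℝ) : Prop :=
  0 < αlo ∧ 0 < αhi ∧ 0 < κ ∧ Continuous V ∧
    (∀ x, αlo * ‖x‖ ^ 2 ≤ V x ∧ V x ≤ αhi * ‖x‖ ^ 2) ∧
    ∀ x, ∃ (b : EReal) (ξ : ℝ → E), IsMaximalSolution v x b ξ ∧
      diniAtZero V ξ ≤ ((-κ * V x : ℝ) : EReal)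

end Dynamics

/-! ## Data -/

/-- One input-state trajectory of every subsystem of the open-loop network over
`[t₀, t₀ + T τ]`, sampled at the times `t₀ + k τ`, and matrices `Λ_i` for the noise bounds. -/
structure Experiment (S : Network) where
  T : ℕ
  T_pos : 0 < T
  t₀ : ℝ
  τ : ℝ
  τ_pos : 0 < τ
  x : ∀ i, ℝ → S.St i
  u : ∀ i, ℝ → S.In i
  continuousOn_x : ∀ i, ContinuousOn (x i) (Set.Icc t₀ (t₀ + T * τ))
  hasDeriv_x : ∀ i, ∀ t ∈ Set.Ico t₀ (t₀ + T * τ),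
    HasDerivWithinAt (x i) (S.subField i (x i t) (S.adv (fun j => x j t) i) (u i t)) (Set.Ici t) t
  /-- number of columns of `Λ_i` -/
  l : ℕ → ℕ
  Λ : ∀ i, Matrix (Fin (S.n i)) (Fin (l i)) ℝ

namespace Experiment

variable {S : Network} (d : Experiment S)

/-- The `k`-th sampling time. -/
noncomputable def time (k : ℕ) : ℝ := d.t₀ + k * d.τ

/-- The matrix `W_i` of the samples of `w_i`. -/
noncomputable def Wmat (i : ℕ) : Matrix (S.Adv i) (Fin d.T) ℝ :=
  Matrix.of fun p k => S.adv (fun j => d.x j (d.time k)) i p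

/-- The matrix `J_i` with columns `F_i(x_i)`. -/
noncomputable def Jmat (i : ℕ) : Matrix (Fin (S.N i)) (Fin d.T) ℝ :=
  Matrix.of fun p k => S.Fval i (d.x i (d.time k)) p

/-- The matrix with columns `G_i(x_i) u_i`. -/
noncomputable def Gmat (i : ℕ) : Matrix (Fin (S.M i)) (Fin d.T) ℝ :=
  Matrix.of fun p k =>
    Matrix.mulVec (S.Gval i (d.x i (d.time k))) (d.u i (d.time k)).ofLp p

/-- The matrix of the true state derivatives at the sampling times. -/
noncomputable def XdTrue (i : ℕ) : Matrix (Fin (S.n i)) (Fin d.T) ℝ :=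
  Matrix.of fun p k => derivWithin (d.x i) (Set.Ici (d.time k)) (d.time k) p

/-- The matrix of the forward differences. -/
noncomputable def Xd (i : ℕ) : Matrix (Fin (S.n i)) (Fin d.T) ℝ :=
  Matrix.of fun p k => (d.x i (d.time (k + 1)) p - d.x i (d.time k) p) / d.τ

/-- The noise matrix `Δ_i`. -/
noncomputable def noise (i : ℕ) : Matrix (Fin (S.n i)) (Fin d.T) ℝ := d.XdTrue i - d.Xd i

/-- `Δ_i Δ_iᵀ ≼ Λ_i Λ_iᵀ`. -/
def NoiseBounded (i : ℕ) : Prop :=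
  LoewnerLE (d.noise i * (d.noise i).transpose) (d.Λ i * (d.Λ i).transpose)

/-- `L_i`, the stacked matrices `J_i`, `G_i`. -/
noncomputable def Lmat (i : ℕ) : Matrix (Fin (S.N i) ⊕ Fin (S.M i)) (Fin d.T) ℝ :=
  Matrix.fromRows (d.Jmat i) (d.Gmat i)

/-- `Q_i`, the stacked matrices `J_i`, `G_i`, `W_i`. -/
noncomputable def Qmat (i : ℕ) :
    Matrix ((Fin (S.N i) ⊕ Fin (S.M i)) ⊕ S.Adv i) (Fin d.T) ℝ :=
  Matrix.fromRows (d.Lmat i) (d.Wmat i)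

/-- The data matrix built from derivative data `Y`, regressors `Q` and a noise bound `Λ`. -/
noncomputable def dataMat {a s t l : Type} [Fintype t] [Fintype l]
    (Y : Matrix a t ℝ) (Q : Matrix s t ℝ) (Λ : Matrix a l ℝ) : Matrix (a ⊕ s) (a ⊕ s) ℝ :=
  Matrix.fromBlocks (Y * Y.transpose - Λ * Λ.transpose) (-(Y * Q.transpose))
    (-(Y * Q.transpose)).transpose (Q * Q.transpose)

end Experiment

/-! ## Data-driven design -/

/-- The design variables: `P_i`, the matrix polynomials `K_i`, the scalar polynomials `γ_i`, the
constants `κ_i`, `ϑ_i`, `ρ_i`, and the bounds `χ_i` on `‖D_i‖`. -/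
structure Design (S : Network) where
  P : ∀ i, Matrix (Fin (S.n i)) (Fin (S.n i)) ℝ
  K : ∀ i, Matrix (Fin (S.m i)) (Fin (S.n i)) (MvPolynomial (Fin (S.n i)) ℝ)
  γ : ∀ i, MvPolynomial (Fin (S.n i)) ℝ
  κ : ℕ → ℝ
  ϑ : ℕ → ℝ
  ρ : ℕ → ℝ
  χ : ℕ → ℝ

namespace Design

variable {S : Network} (c : Design S)

/-- The value of the matrix polynomial `K_i`. -/
noncomputable def Kval (i : ℕ) (x : S.St i) : Matrix (Fin (S.m i)) (Fin (S.n i)) ℝ :=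
  (c.K i).map (MvPolynomial.eval x.ofLp)

/-- The local controller `u_i = K_i(x_i) P_i x_i`. -/
noncomputable def control (i : ℕ) (x : S.St i) : S.In i :=
  WithLp.toLp 2 (Matrix.mulVec (c.Kval i x * c.P i) x.ofLp)

/-- The quadratic function `V_i(x_i) = x_iᵀ P_i x_i`. -/
noncomputable def V (i : ℕ) (x : S.St i) : ℝ := dotProduct x.ofLp (Matrix.mulVec (c.P i) x.ofLp)

/-- The block `[Ψ_i P_i⁻¹; G_i K_i]`. -/
noncomputable def loopBlock (i : ℕ) (x : S.St i) :
    Matrix (Fin (S.N i) ⊕ Fin (S.M i)) (Fin (S.n i)) ℝ :=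
  Matrix.fromRows (S.Ψval i x * (c.P i)⁻¹) (S.Gval i x * c.Kval i x)

/-- The matrix inequality for unknown `D_i`. -/
def UnknownLMI (d : Experiment S) (i : ℕ) : Prop :=
  ∀ x : S.St i, LoewnerLE
    (Matrix.fromBlocks 0 (Matrix.fromRows (c.loopBlock i x) 0).transpose
        (Matrix.fromRows (c.loopBlock i x) 0) 0
      + (c.ϑ i + c.κ i) • Matrix.fromBlocks (c.P i)⁻¹ 0 0 0
      - MvPolynomial.eval x.ofLp (c.γ i) •
        Experiment.dataMat (d.Xd i) (d.Qmat i) (d.Λ i)) 0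

/-- The matrix inequality for known `D_i`. -/
def KnownLMI (d : Experiment S) (i : ℕ) : Prop :=
  ∀ x : S.St i, LoewnerLE
    (Matrix.fromBlocks 0 (c.loopBlock i x).transpose (c.loopBlock i x) 0
      + (c.ϑ i + c.κ i) • Matrix.fromBlocks (c.P i)⁻¹ 0 0 0
      - MvPolynomial.eval x.ofLp (c.γ i) •
        Experiment.dataMat (d.Xd i - S.D i * d.Wmat i) (d.Lmat i) (d.Λ i)) 0

/-- The design of subsystem `i` comes from the data `d`: either only the bound `χ_i` on `‖D_i‖`
is used, or the matrix `D_i` itself. -/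
def FromData (d : Experiment S) (i : ℕ) : Prop :=
  d.NoiseBounded i ∧ (c.P i).PosDef ∧ 0 < c.κ i ∧ 0 < c.ϑ i ∧
    (∀ x : S.St i, 0 ≤ MvPolynomial.eval x.ofLp (c.γ i)) ∧
    ((0 < c.χ i ∧ specNorm (S.D i) ≤ c.χ i ∧ c.UnknownLMI d i ∧
        c.ρ i = specNorm (matSqrt (c.P i)) ^ 2 * c.χ i ^ 2 / c.ϑ i) ∨
      (c.KnownLMI d i ∧
        c.ρ i = specNorm (matSqrt (c.P i)) ^ 2 * specNorm (S.D i) ^ 2 / c.ϑ i))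

/-- `Θ = (θ_ij)` with `θ_ij = ρ_i / λ_min(P_j)` for `j ∈ nbr i` and `θ_ij = 0` otherwise. -/
noncomputable def Θ (i j : ℕ) : ℝ := if j ∈ S.nbr i then c.ρ i / lamMin (c.P j) else 0

/-- The entries `θ_ij / κ_i` of the gain operator. -/
noncomputable def gain (i j : ℕ) : ℝ := c.Θ i j / c.κ i

theorem colBounded_gain {κlo : ℝ} (h0 : 0 < κlo) (hκ : ∀ i, κlo ≤ c.κ i)
    (hΘ : ColBounded c.Θ) : ColBounded c.gain := by
  have key : ∀ i j, ‖c.gain i j‖ₑ ≤ ‖κlo⁻¹‖ₑ * ‖c.Θ i j‖ₑ := fun i j => by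
    rw [← enorm_mul, enorm_le_iff_norm_le, norm_mul, gain, div_eq_inv_mul, norm_mul]
    refine mul_le_mul_of_nonneg_right ?_ (norm_nonneg _)
    rw [norm_inv, norm_inv, Real.norm_of_nonneg h0.le, Real.norm_of_nonneg (h0.le.trans (hκ i))]
    exact inv_anti₀ h0 (hκ i)
  refine lt_of_le_of_lt (b := ‖κlo⁻¹‖ₑ * ⨆ j, ∑' i, ‖c.Θ i j‖ₑ) (iSup_le fun j => ?_)
    (ENNReal.mul_lt_top enorm_lt_top hΘ)
  calc ∑' i, ‖c.gain i j‖ₑ ≤ ∑' i, ‖κlo⁻¹‖ₑ * ‖c.Θ i j‖ₑ := ENNReal.tsum_le_tsum fun i => key i j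
    _ = ‖κlo⁻¹‖ₑ * ∑' i, ‖c.Θ i j‖ₑ := ENNReal.tsum_mul_left
    _ ≤ _ := by
      gcongr
      exact le_iSup (fun j => ∑' i, ‖c.Θ i j‖ₑ) j

/-- The gain operator `Ω = 𝒦⁻¹ Θ` on `ℓ¹`. -/
noncomputable def Ω {κlo : ℝ} (h0 : 0 < κlo) (hκ : ∀ i, κlo ≤ c.κ i) (hΘ : ColBounded c.Θ) :
    lp (fun _ : ℕ => ℂ) 1 →L[ℂ] lp (fun _ : ℕ => ℂ) 1 :=
  matrixOp c.gain (c.colBounded_gain h0 hκ hΘ)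

end Design

/-!
# Stability of an infinite network by a weighted sum of quadratic Lyapunov functions

*Subsystems.* The true system matrices `R = [A_i B_i]` (or `[A_i B_i D_i]`) explain the data up to
the noise, `Y = R Q - Δ_i`, and `Δ_i Δ_iᵀ ≼ Λ_i Λ_iᵀ` says that the quadratic form of the data matrix
is nonpositive on the vectors `(z, Rᵀ z)`. The matrix inequality of the design, evaluated on these
vectors with `z = P_i x_i`, therefore bounds the derivative of `V_i` along the true undisturbed loop
(`dissipation_of_dataMat`). Young's inequality for the disturbance gives
`V_i' ≤ -κ_i V_i + ρ_i |w_i|²` (`Design.FromData.dissipation`), and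
`ρ_i |w_i|² ≤ ∑_j θ_ij V_j`.

*Weights.* For `r(Ω) < q` the Neumann series `ν = ∑ₖ q⁻ᵏ 𝟙ᵀ Ωᵏ` converges in the dual of `ℓ¹` by
Gelfand's formula, and `ν ≥ 1`, `νᵀ Ω ≤ q νᵀ` (`exists_subinvariant_weight`). With `μ_i = ν_i / κ_i`
the local inequalities add up to `V' ≤ -(1 - q) (inf κ_i) V` for `V = ∑ μ_i V_i`
(`Design.weightedForm_decay`). That `inf μ_i > 0` needs an upper bound for the rates `κ_i`; it comes
from the Lipschitz constant of the closed loop near the origin (`Design.exists_forall_kappa_le`).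

*Solutions.* The closed loop is Lipschitz on the balls of `ℓ²`: the coupling operator and the input
operator at the origin are defined on all of `ℓ²` and have continuous coordinates, so they are
bounded by the closed graph theorem (`Network.lipschitzOnBalls_closedLoop`). `V` is a bounded
quadratic form on `ℓ²`, equivalent to the squared norm. Hence it is differentiable along solutions,
confines them to balls, which makes them global (`exists_global_solution`), and its exponential
decay gives the `𝒦ℒ` bound.
-/

/-! ### Quadratic forms and the matrix S-procedure -/

section QuadraticForms

open Matrix

variable {a s t l : Type} [Fintype a] [Fintype s] [Fintype t] [Fintype l]

theorem dotProduct_mul_transpose_mulVec (A : Matrix a t ℝ) (B : Matrix s t ℝ) (z : a → ℝ)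
    (y : s → ℝ) : z ⬝ᵥ (A * Bᵀ) *ᵥ y = (Aᵀ *ᵥ z) ⬝ᵥ (Bᵀ *ᵥ y) := by
  rw [← mulVec_mulVec, dotProduct_mulVec, ← mulVec_transpose]

theorem LoewnerLE.dotProduct_mulVec_le {A B : Matrix a a ℝ} (h : LoewnerLE A B) (z : a → ℝ) :
    z ⬝ᵥ A *ᵥ z ≤ z ⬝ᵥ B *ᵥ z := by
  have := Matrix.PosSemidef.dotProduct_mulVec_nonneg h z
  rw [star_trivial, sub_mulVec, dotProduct_sub] at this
  linarith

theorem Matrix.PosDef.dotProduct_mulVec_comm {P : Matrix a a ℝ} (hP : P.PosDef) (x y : a → ℝ) :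
    x ⬝ᵥ P *ᵥ y = y ⬝ᵥ P *ᵥ x := by
  have h : Pᵀ = P := by simpa using hP.isHermitian.eq
  rw [dotProduct_mulVec, ← mulVec_transpose, h, dotProduct_comm]

/-- The matrix S-procedure: a model `R` for which the residual `Y - R Q` respects the noise bound
inherits the matrix inequality that was imposed on the data. The inequality is tested on the vector
`(z, Rᵀ z)`, on which the quadratic form of the data matrix is the one of
`(Y - R Q) (Y - R Q)ᵀ - Λ Λᵀ`. -/
theorem dissipation_of_dataMat {Y : Matrix a t ℝ} {Q : Matrix s t ℝ} {Λ : Matrix a l ℝ}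
    {R : Matrix a s ℝ} {C : Matrix s a ℝ} {M : Matrix a a ℝ} {q γ : ℝ} (hγ : 0 ≤ γ)
    (hnoise : LoewnerLE ((Y - R * Q) * (Y - R * Q)ᵀ) (Λ * Λᵀ))
    (hLMI : LoewnerLE (fromBlocks 0 Cᵀ C 0 + q • fromBlocks M 0 0 0
      - γ • Experiment.dataMat Y Q Λ) 0) (z : a → ℝ) :
    2 * (z ⬝ᵥ R *ᵥ (C *ᵥ z)) + q * (z ⬝ᵥ M *ᵥ z) ≤ 0 := by
  have h1 := hLMI.dotProduct_mulVec_le (Sum.elim z (Rᵀ *ᵥ z))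
  have h2 := hnoise.dotProduct_mulVec_le z
  have h3 : (Y - R * Q)ᵀ *ᵥ z = Yᵀ *ᵥ z - Qᵀ *ᵥ (Rᵀ *ᵥ z) := by
    rw [transpose_sub, transpose_mul, sub_mulVec, mulVec_mulVec]
  rw [dotProduct_mul_transpose_mulVec, dotProduct_mul_transpose_mulVec, h3] at h2
  have h4 : (Rᵀ *ᵥ z) ⬝ᵥ (C *ᵥ z) = z ⬝ᵥ R *ᵥ (C *ᵥ z) := by
    rw [dotProduct_mulVec z, ← mulVec_transpose]
  have h5 : z ⬝ᵥ Cᵀ *ᵥ (Rᵀ *ᵥ z) = z ⬝ᵥ R *ᵥ (C *ᵥ z) := by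
    rw [dotProduct_mulVec, ← mulVec_transpose, transpose_transpose, dotProduct_comm, h4]
  simp only [Experiment.dataMat, sub_mulVec, add_mulVec, smul_mulVec, fromBlocks_mulVec,
    zero_mulVec, dotProduct_zero, dotProduct_sub, dotProduct_add, dotProduct_smul,
    sumElim_dotProduct_sumElim, zero_add, add_zero, neg_mulVec, dotProduct_neg, transpose_neg,
    transpose_mul, transpose_transpose, dotProduct_mul_transpose_mulVec, smul_eq_mul,
    Sum.elim_comp_inl, Sum.elim_comp_inr, h4, h5, sub_dotProduct] at h1 h2
  have h6 := mul_le_mul_of_nonneg_left h2 hγ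
  linarith

theorem dotProduct_self_eq_norm_sq (x : EuclideanSpace ℝ a) : x.ofLp ⬝ᵥ x.ofLp = ‖x‖ ^ 2 := by
  rw [EuclideanSpace.real_norm_sq_eq, dotProduct]
  exact Finset.sum_congr rfl fun i _ => (sq _).symm

variable [DecidableEq s]

theorem specNorm_nonneg (A : Matrix a s ℝ) : 0 ≤ specNorm A := by
  open scoped Matrix.Norms.L2Operator in exact norm_nonneg A

theorem norm_toLp_mulVec_le (A : Matrix a s ℝ) (x : EuclideanSpace ℝ s) :
    ‖WithLp.toLp 2 (A *ᵥ x.ofLp)‖ ≤ specNorm A * ‖x‖ :=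
  l2_opNorm_mulVec A x

theorem dotProduct_mulVec_self_le_specNorm (A : Matrix a s ℝ) (x : s → ℝ) :
    (A *ᵥ x) ⬝ᵥ (A *ᵥ x) ≤ specNorm A ^ 2 * (x ⬝ᵥ x) := by
  have h := norm_toLp_mulVec_le A (WithLp.toLp 2 x)
  have h1 := dotProduct_self_eq_norm_sq (WithLp.toLp 2 x)
  have h2 := dotProduct_self_eq_norm_sq (WithLp.toLp 2 (A *ᵥ x))
  simp only at h h1 h2
  rw [h1, h2, ← mul_pow]
  exact pow_le_pow_left₀ (norm_nonneg _) h 2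

variable [DecidableEq a]

open scoped MatrixOrder Matrix.Norms.L2Operator in
theorem lamMin_mul_le {P : Matrix a a ℝ} (hP : P.PosDef) (x : a → ℝ) :
    lamMin P * (x ⬝ᵥ x) ≤ x ⬝ᵥ P *ᵥ x := by
  have h : algebraMap ℝ (Matrix a a ℝ) (lamMin P) ≤ P :=
    (algebraMap_le_iff_le_spectrum (ha := hP.isHermitian.isSelfAdjoint)).2 fun r hr =>
      csInf_le (spectrum.isCompact P).bddBelow hr
  have := LoewnerLE.dotProduct_mulVec_le (Matrix.le_iff.1 h) x
  simpa [Algebra.algebraMap_eq_smul_one, smul_mulVec] using this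

open scoped MatrixOrder Matrix.Norms.L2Operator in
theorem le_lamMax_mul {P : Matrix a a ℝ} (hP : P.PosDef) (x : a → ℝ) :
    x ⬝ᵥ P *ᵥ x ≤ lamMax P * (x ⬝ᵥ x) := by
  have h : P ≤ algebraMap ℝ (Matrix a a ℝ) (lamMax P) :=
    (le_algebraMap_iff_spectrum_le (ha := hP.isHermitian.isSelfAdjoint)).2 fun r hr =>
      le_csSup (spectrum.isCompact P).bddAbove hr
  have := LoewnerLE.dotProduct_mulVec_le (Matrix.le_iff.1 h) x
  simpa [Algebra.algebraMap_eq_smul_one, smul_mulVec] using this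

open scoped MatrixOrder Matrix.Norms.L2Operator in
theorem dotProduct_mulVec_le_specNorm_matSqrt {P : Matrix a a ℝ} (hP : P.PosDef) (x : a → ℝ) :
    x ⬝ᵥ P *ᵥ x ≤ specNorm (matSqrt P) ^ 2 * (x ⬝ᵥ x) := by
  have h0 : matSqrt P * matSqrt P = P := CFC.sqrt_mul_sqrt_self P hP.posSemidef.nonneg
  have h1 : (matSqrt P)ᵀ = matSqrt P := by
    have := (IsSelfAdjoint.of_nonneg (CFC.sqrt_nonneg P)).star_eq
    rwa [star_eq_conjTranspose, conjTranspose_eq_transpose_of_trivial] at this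
  have h2 : x ⬝ᵥ P *ᵥ x = (matSqrt P *ᵥ x) ⬝ᵥ (matSqrt P *ᵥ x) := by
    conv_lhs => rw [← h0]
    nth_rw 2 [← h1]
    rw [dotProduct_mul_transpose_mulVec, h1]
  rw [h2]
  exact dotProduct_mulVec_self_le_specNorm _ x

/-- The disturbance term of the dissipation inequality, by Young's inequality in the inner product
of `P`. -/
theorem two_mul_dotProduct_disturbance_le {P : Matrix a a ℝ} (hP : P.PosDef) (D : Matrix a s ℝ)
    {ϑ b : ℝ} (hϑ : 0 < ϑ) (hb : specNorm D ≤ b) (x : a → ℝ) (w : s → ℝ) :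
    2 * (x ⬝ᵥ P *ᵥ (D *ᵥ w)) ≤ ϑ * (x ⬝ᵥ P *ᵥ x)
      + specNorm (matSqrt P) ^ 2 * b ^ 2 / ϑ * (w ⬝ᵥ w) := by
  set y := D *ᵥ w with hy
  have hw : 0 ≤ w ⬝ᵥ w := by
    simpa using dotProduct_star_self_nonneg w
  have h1 : y ⬝ᵥ P *ᵥ y ≤ specNorm (matSqrt P) ^ 2 * (b ^ 2 * (w ⬝ᵥ w)) :=
    (dotProduct_mulVec_le_specNorm_matSqrt hP y).trans <| mul_le_mul_of_nonneg_left
      ((dotProduct_mulVec_self_le_specNorm D w).trans <| mul_le_mul_of_nonneg_right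
        (pow_le_pow_left₀ (specNorm_nonneg D) hb 2) hw) (sq_nonneg _)
  have h2 := hP.posSemidef.dotProduct_mulVec_nonneg (ϑ • x - y)
  simp only [star_trivial, mulVec_sub, mulVec_smul, dotProduct_sub, sub_dotProduct,
    dotProduct_smul, smul_dotProduct, smul_eq_mul, hP.dotProduct_mulVec_comm y x] at h2
  have h3 : specNorm (matSqrt P) ^ 2 * b ^ 2 / ϑ * (w ⬝ᵥ w)
      = (specNorm (matSqrt P) ^ 2 * (b ^ 2 * (w ⬝ᵥ w))) / ϑ := by ring
  rw [h3, ← sub_le_iff_le_add', le_div_iff₀ hϑ]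
  linarith

end QuadraticForms

/-! ### Dissipation inequalities of the subsystems -/

namespace Network

open Matrix

variable {S : Network}

theorem Fval_eq (i : ℕ) (x : S.St i) : S.Fval i x = S.Ψval i x *ᵥ x.ofLp := by
  ext k
  simp [Fval, Ψval, S.F_eq, mulVec, dotProduct]

theorem f_eq (i : ℕ) (x : S.St i) : (S.f i x).ofLp = S.A i *ᵥ (S.Ψval i x *ᵥ x.ofLp) := by
  rw [f, Fval_eq]

end Network

namespace Experiment

open Matrix

variable {S : Network} (d : Experiment S) (i : ℕ)

/-- The samples of the true derivative, in terms of the regressors `L_i` and `W_i`. -/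
theorem XdTrue_eq : d.XdTrue i = fromCols (S.A i) (S.B i) * d.Lmat i + S.D i * d.Wmat i := by
  ext p k
  have hk : d.time k ∈ Set.Ico d.t₀ (d.t₀ + d.T * d.τ) := by
    have h : (k : ℝ) < d.T := by exact_mod_cast k.2
    have := mul_lt_mul_of_pos_right h d.τ_pos
    have := mul_nonneg (Nat.cast_nonneg (α := ℝ) k) d.τ_pos.le
    constructor <;> simp only [time] <;> linarith
  have h := (d.hasDeriv_x i _ hk).derivWithin (uniqueDiffWithinAt_Ici _)
  have h1 : d.XdTrue i p k = S.subField i (d.x i (d.time k))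
      (S.adv (fun j => d.x j (d.time k)) i) (d.u i (d.time k)) p := by
    rw [← h]; rfl
  rw [h1, Lmat, fromCols_mul_fromRows]
  simp only [Network.subField, Network.f, Network.g, PiLp.add_apply, Matrix.add_apply]
  rw [← mulVec_mulVec]
  rfl

end Experiment

namespace Design

open Matrix

variable {S : Network} {c : Design S} {d : Experiment S} {i : ℕ}

theorem loop_eq (hP : (c.P i).PosDef) (x : S.St i) :
    fromCols (S.A i) (S.B i) *ᵥ (c.loopBlock i x *ᵥ (c.P i *ᵥ x.ofLp))
      = (S.f i x).ofLp + S.g i x *ᵥ (c.control i x).ofLp := by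
  have hdet : IsUnit (c.P i).det := (Matrix.isUnit_iff_isUnit_det _).1 hP.isUnit
  rw [loopBlock, fromRows_mulVec, fromCols_mulVec_sumElim, Network.f_eq, control, Network.g]
  congr 1
  · simp only [mulVec_mulVec, Matrix.mul_assoc, nonsing_inv_mul _ hdet, Matrix.mul_one]
  · simp only [mulVec_mulVec, Matrix.mul_assoc]

/-- Both matrix inequalities make `V_i` decrease at rate `ϑ_i + κ_i` along the undisturbed loop. -/
theorem FromData.undisturbed (h : c.FromData d i) (x : S.St i) :
    2 * (x.ofLp ⬝ᵥ c.P i *ᵥ ((S.f i x).ofLp + S.g i x *ᵥ (c.control i x).ofLp))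
      + (c.ϑ i + c.κ i) * c.V i x ≤ 0 := by
  obtain ⟨hN, hP, -, -, hγ, h⟩ := h
  have hdet : IsUnit (c.P i).det := (Matrix.isUnit_iff_isUnit_det _).1 hP.isUnit
  have hV : c.V i x = (c.P i *ᵥ x.ofLp) ⬝ᵥ (c.P i)⁻¹ *ᵥ (c.P i *ᵥ x.ofLp) := by
    rw [mulVec_mulVec, nonsing_inv_mul _ hdet, one_mulVec, V, dotProduct_comm]
  rw [hP.dotProduct_mulVec_comm, dotProduct_comm, ← loop_eq hP, hV]
  have htr := d.XdTrue_eq i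
  rcases h with ⟨-, -, h, -⟩ | ⟨h, -⟩
  · have hres : d.Xd i - fromCols (fromCols (S.A i) (S.B i)) (S.D i) * d.Qmat i = -d.noise i := by
      rw [Experiment.Qmat, fromCols_mul_fromRows, Experiment.noise, htr]
      abel
    have := dissipation_of_dataMat (R := fromCols (fromCols (S.A i) (S.B i)) (S.D i)) (hγ x)
      (by rwa [hres, transpose_neg, Matrix.neg_mul, Matrix.mul_neg, neg_neg]) (h x) (c.P i *ᵥ x.ofLp)
    simpa only [fromRows_mulVec, fromCols_mulVec_sumElim, zero_mulVec, mulVec_zero, add_zero]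
      using this
  · have hres : d.Xd i - S.D i * d.Wmat i - fromCols (S.A i) (S.B i) * d.Lmat i
        = -d.noise i := by
      rw [Experiment.noise, htr]
      abel
    exact dissipation_of_dataMat (hγ x)
      (by rwa [hres, transpose_neg, Matrix.neg_mul, Matrix.mul_neg, neg_neg]) (h x) _

/-- The dissipation inequality of a subsystem with decay rate `κ_i` and gain `ρ_i`. -/
theorem FromData.dissipation (h : c.FromData d i) (x : S.St i) (w : S.Adv i → ℝ) :
    2 * (x.ofLp ⬝ᵥ c.P i *ᵥ (S.subField i x w (c.control i x)).ofLp)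
      ≤ -c.κ i * c.V i x + c.ρ i * (w ⬝ᵥ w) := by
  have h0 := h.undisturbed x
  obtain ⟨-, hP, -, hϑ, -, h⟩ := h
  have h1 : 2 * (x.ofLp ⬝ᵥ c.P i *ᵥ (S.D i *ᵥ w)) ≤ c.ϑ i * c.V i x + c.ρ i * (w ⬝ᵥ w) := by
    rcases h with ⟨-, hD, -, hρ⟩ | ⟨-, hρ⟩ <;> rw [hρ]
    · exact two_mul_dotProduct_disturbance_le hP _ hϑ hD _ _
    · exact two_mul_dotProduct_disturbance_le hP _ hϑ le_rfl _ _
  simp only [Network.subField, WithLp.ofLp_add, mulVec_add, dotProduct_add] at h0 ⊢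
  linarith

theorem FromData.rho_nonneg (h : c.FromData d i) : 0 ≤ c.ρ i := by
  obtain ⟨-, -, -, hϑ, -, ⟨-, -, -, h⟩ | ⟨-, h⟩⟩ := h <;> rw [h] <;> positivity

end Design

/-! ### Subinvariant weights from a spectral radius condition -/

theorem summable_inv_pow_mul_norm_pow {A : Type*} [NormedRing A] [NormedAlgebra ℂ A]
    [CompleteSpace A] (T : A) {q : ℝ} (hq : spectralRadius ℂ T < ENNReal.ofReal q) :
    Summable fun k => q⁻¹ ^ k * ‖T ^ k‖ := by
  obtain ⟨p, hp, hpq⟩ := ENNReal.lt_iff_exists_nnreal_btwn.1 hq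
  have hq0 : 0 < q := ENNReal.ofReal_pos.1 (bot_le.trans_lt hq)
  have hpq' : (p : ℝ) < q := (ENNReal.lt_ofReal_iff_toReal_lt ENNReal.coe_ne_top).1 hpq
  have hgeo : Summable fun k => ((p : ℝ) / q) ^ k :=
    summable_geometric_of_lt_one (by positivity) ((div_lt_one hq0).2 hpq')
  refine hgeo.of_norm_bounded_eventually_nat ?_
  filter_upwards [(spectrum.pow_nnnorm_pow_one_div_tendsto_nhds_spectralRadius T).eventually_lt_const
    hp, Filter.eventually_gt_atTop 0] with k hk hk0
  have h1 : (‖T ^ k‖₊ : ℝ≥0∞) ≤ (p : ℝ≥0∞) ^ k := by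
    rw [one_div] at hk
    have := ENNReal.rpow_le_rpow hk.le (Nat.cast_nonneg k)
    rwa [← ENNReal.rpow_mul, inv_mul_cancel₀ (by exact_mod_cast hk0.ne'), ENNReal.rpow_one,
      ENNReal.rpow_natCast] at this
  have h2 : ‖T ^ k‖ ≤ (p : ℝ) ^ k := by exact_mod_cast h1
  rw [Real.norm_of_nonneg (by positivity), div_eq_inv_mul, mul_pow]
  exact mul_le_mul_of_nonneg_left h2 (by positivity)

/-- A nonnegative matrix acting on `ℓ¹` with spectral radius less than `q` admits a bounded weight
`ν ≥ 1` with `νᵀ a ≤ q νᵀ`. The weight is `ν = ∑ₖ q⁻ᵏ 𝟙ᵀ aᵏ`, a Neumann series in the dual of `ℓ¹`,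
and `νᵀ a = q (ν - 𝟙)ᵀ`. -/
theorem exists_subinvariant_weight {a : ℕ → ℕ → ℝ} (h : ColBounded a) (ha : ∀ i j, 0 ≤ a i j)
    {q : ℝ} (hq : spectralRadius ℂ (matrixOp a h) < ENNReal.ofReal q) :
    ∃ (ν : ℕ → ℝ) (C : ℝ), (∀ j, 1 ≤ ν j ∧ ν j ≤ C) ∧
      ∀ j, Summable (fun i => ν i * a i j) ∧ ∑' i, ν i * a i j ≤ q * ν j := by
  have hq0 : 0 < q := ENNReal.ofReal_pos.1 (bot_le.trans_lt hq)
  set T := matrixOp a h with hT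
  let e : ℕ → lp (fun _ : ℕ => ℂ) 1 := fun j => lp.single 1 j 1
  let φ : ℕ → lp (fun _ : ℕ => ℂ) 1 →L[ℂ] ℂ := fun k => (lp.tsumCLM ℂ ℕ ℂ).comp (T ^ k)
  have hTe : ∀ j, T (e j) = h.col j := fun j => by
    ext i
    rw [hT, matrixOp_apply, tsum_eq_single j]
    · simp [e, ColBounded.col]
    · intro j' hj
      simp [e, hj]
  -- Every bounded functional is determined by its values on the unit vectors.
  have hcol : ∀ (ψ : lp (fun _ : ℕ => ℂ) 1 →L[ℂ] ℂ) (j : ℕ),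
      HasSum (fun i => (a i j : ℂ) * ψ (e i)) (ψ (T (e j))) := fun ψ j => by
    rw [hTe]
    convert (lp.hasSum_single ENNReal.one_ne_top (h.col j)).mapL ψ using 2 with i
    rw [← smul_eq_mul, ← map_smul, ← lp.single_smul]
    simp [ColBounded.col]
  have hφT : ∀ k x, φ k (T x) = φ (k + 1) x := fun k x => by
    simp [φ, pow_succ]
  have hφ0 : ∀ j, φ 0 (e j) = 1 := fun j => by
    change ∑' i, e j i = 1
    rw [tsum_eq_single j (fun i hi => by simp [e, hi])]
    simp [e]
  have hpos : ∀ k j, (φ k (e j)).im = 0 ∧ 0 ≤ (φ k (e j)).re := by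
    intro k
    induction k with
    | zero => intro j; simp [hφ0]
    | succ k ih =>
      intro j
      have h1 := hcol (φ k) j
      rw [hφT] at h1
      have hre := Complex.hasSum_re h1
      have him := Complex.hasSum_im h1
      simp only [Complex.re_ofReal_mul, Complex.im_ofReal_mul, (ih _).1, mul_zero] at hre him
      exact ⟨him.unique hasSum_zero, hre.nonneg fun i => mul_nonneg (ha i j) (ih i).2⟩
  have hsum : Summable fun k => ((q⁻¹ ^ k : ℝ) : ℂ) • φ k := by
    refine Summable.of_norm_bounded
      ((summable_inv_pow_mul_norm_pow T hq).mul_left ‖lp.tsumCLM ℂ ℕ ℂ‖) fun k => ?_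
    rw [norm_smul, Complex.norm_real, Real.norm_of_nonneg (by positivity), mul_left_comm]
    exact mul_le_mul_of_nonneg_left (ContinuousLinearMap.opNorm_comp_le _ _) (by positivity)
  set Φ := ∑' k, ((q⁻¹ ^ k : ℝ) : ℂ) • φ k with hΦ
  have hΦx : ∀ x, HasSum (fun k => ((q⁻¹ ^ k : ℝ) : ℂ) * φ k x) (Φ x) := fun x =>
    hsum.hasSum.mapL (ContinuousLinearMap.apply ℂ ℂ x)
  have hν : ∀ j, HasSum (fun k => q⁻¹ ^ k * (φ k (e j)).re) (Φ (e j)).re := fun j => by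
    simpa only [Complex.re_ofReal_mul] using Complex.hasSum_re (hΦx (e j))
  have hν1 : ∀ j, 1 ≤ (Φ (e j)).re := fun j => by
    have := le_hasSum (hν j) 0 fun k _ => mul_nonneg (by positivity) (hpos k j).2
    simpa [hφ0] using this
  have hinv : ∀ j, (Φ (T (e j))).re = q * ((Φ (e j)).re - 1) := fun j => by
    have h1 : HasSum (fun k => q⁻¹ ^ k * (φ (k + 1) (e j)).re) (Φ (T (e j))).re := by
      simpa only [Complex.re_ofReal_mul, hφT] using Complex.hasSum_re (hΦx (T (e j)))
    have h2 := ((hasSum_nat_add_iff' 1).2 (hν j)).mul_left q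
    simp only [Finset.range_one, Finset.sum_singleton, pow_zero, one_mul, hφ0, Complex.one_re]
      at h2
    have h3 : (fun k => q * (q⁻¹ ^ (k + 1) * (φ (k + 1) (e j)).re))
        = fun k => q⁻¹ ^ k * (φ (k + 1) (e j)).re := by
      funext k
      rw [pow_succ]
      field_simp
    rw [h3] at h2
    exact h1.unique h2
  refine ⟨fun j => (Φ (e j)).re, ‖Φ‖, fun j => ⟨hν1 j, ?_⟩, fun j => ?_⟩
  · refine (Complex.re_le_norm _).trans ((Φ.le_opNorm _).trans (le_of_eq ?_))
    rw [lp.norm_single (by simp), norm_one, mul_one]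
  · have h1 : HasSum (fun i => (Φ (e i)).re * a i j) (Φ (T (e j))).re := by
      simpa only [Complex.re_ofReal_mul, mul_comm] using Complex.hasSum_re (hcol Φ j)
    refine ⟨h1.summable, ?_⟩
    rw [h1.tsum_eq, hinv]
    linarith

/-! ### Autonomous differential equations with a quadratic Lyapunov function -/

section LyapunovTheory

open Set

/-- Lipschitz continuity on every bounded ball. -/
def LipschitzOnBalls {E F : Type*} [SeminormedAddCommGroup E] [SeminormedAddCommGroup F]
    (v : E → F) : Prop :=
  ∀ R : ℝ, 0 < R → ∃ L : ℝ, 0 < L ∧ ∀ x y : E, ‖x‖ ≤ R → ‖y‖ ≤ R → ‖v x - v y‖ ≤ L * ‖x - y‖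

theorem diniAtZero_eq_of_hasDerivWithinAt {E : Type} {V : E → ℝ} {ξ : ℝ → E} {D : ℝ}
    (h : HasDerivWithinAt (fun t => V (ξ t)) D (Ici 0) 0) : diniAtZero V ξ = (D : EReal) := by
  have h1 := (hasDerivWithinAt_iff_tendsto_slope' self_notMem_Ioi).1 (h.mono Ioi_subset_Ici_self)
  have h2 : Filter.Tendsto (fun s : ℝ => (((V (ξ s) - V (ξ 0)) / s : ℝ) : EReal)) (𝓝[>] 0)
      (𝓝 (D : EReal)) := by
    refine (continuous_coe_real_ereal.tendsto D).comp (h1.congr fun s => ?_)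
    rw [slope_def_field, sub_zero]
  exact h2.limsup_eq

variable {E : Type} [NormedAddCommGroup E]

theorem LipschitzOnBalls.lipschitzOnWith {v : E → E} (hv : LipschitzOnBalls v) {R : ℝ}
    (hR : 0 < R) : ∃ K : ℝ≥0, LipschitzOnWith K v (Metric.closedBall 0 R) := by
  obtain ⟨L, hL, h⟩ := hv R hR
  refine ⟨⟨L, hL.le⟩, LipschitzOnWith.of_dist_le_mul fun x hx y hy => ?_⟩
  rw [dist_eq_norm, dist_eq_norm]
  exact h x y (mem_closedBall_zero_iff.1 hx) (mem_closedBall_zero_iff.1 hy)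

theorem LipschitzOnBalls.continuous {v : E → E} (hv : LipschitzOnBalls v) : Continuous v := by
  refine continuous_iff_continuousAt.2 fun x => ?_
  obtain ⟨K, hK⟩ := hv.lipschitzOnWith (R := ‖x‖ + 1) (by positivity)
  refine hK.continuousOn.continuousAt (Filter.mem_of_superset
    (Metric.ball_mem_nhds x one_pos) fun y hy => ?_)
  rw [mem_closedBall_zero_iff]
  have := norm_le_norm_add_norm_sub' y x
  rw [Metric.mem_ball, dist_eq_norm] at hy
  linarith

variable [NormedSpace ℝ E]

/-- Damping `v` outside the ball of radius `R` by a scalar factor in `[0, 1]` makes it bounded and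
globally Lipschitz. -/
theorem LipschitzOnBalls.exists_cutoff {v : E → E} (hv : LipschitzOnBalls v) {R : ℝ}
    (hR : 0 < R) : ∃ (c : E → ℝ) (K M : ℝ≥0), LipschitzWith K (fun x => c x • v x) ∧
      (∀ x, ‖c x • v x‖ ≤ M) ∧ (∀ x, 0 ≤ c x) ∧ ∀ x, ‖x‖ ≤ R → c x = 1 := by
  obtain ⟨L, hL, hLv⟩ := hv (2 * R) (by positivity)
  let c : E → ℝ := fun x => max 0 (min 1 (2 - ‖x‖ / R))
  set M : ℝ := ‖v 0‖ + L * (2 * R) with hM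
  have hM0 : 0 ≤ M := by positivity
  have hc0 : ∀ x, 0 ≤ c x := fun x => le_max_left _ _
  have hc1 : ∀ x, c x ≤ 1 := fun x => max_le zero_le_one (min_le_left _ _)
  have hcout : ∀ x, 2 * R < ‖x‖ → c x = 0 := fun x hx => by
    have : 2 < ‖x‖ / R := by rwa [lt_div_iff₀ hR]
    exact max_eq_left ((min_le_right _ _).trans (by linarith))
  have hclip : ∀ x y, |c x - c y| ≤ R⁻¹ * ‖x - y‖ := fun x y => by
    have h1 : |c x - c y| ≤ |min 1 (2 - ‖x‖ / R) - min 1 (2 - ‖y‖ / R)| := by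
      simp only [c, max_comm (0 : ℝ)]
      exact abs_max_sub_max_le_abs _ _ _
    have h2 : |min 1 (2 - ‖x‖ / R) - min 1 (2 - ‖y‖ / R)| ≤ |(2 - ‖x‖ / R) - (2 - ‖y‖ / R)| := by
      simpa using abs_min_sub_min_le_max 1 (2 - ‖x‖ / R) 1 (2 - ‖y‖ / R)
    refine h1.trans (h2.trans ?_)
    have h3 : (2 - ‖x‖ / R) - (2 - ‖y‖ / R) = R⁻¹ * (‖y‖ - ‖x‖) := by ring
    rw [h3, abs_mul, abs_of_pos (inv_pos.2 hR), norm_sub_rev]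
    exact mul_le_mul_of_nonneg_left (abs_norm_sub_norm_le _ _) (inv_pos.2 hR).le
  have hvM : ∀ x, ‖x‖ ≤ 2 * R → ‖v x‖ ≤ M := fun x hx => by
    have h1 := hLv x 0 hx (by simpa using hR.le)
    have h2 := norm_le_norm_add_norm_sub' (v x) (v 0)
    rw [sub_zero] at h1
    have h3 := mul_le_mul_of_nonneg_left hx hL.le
    linarith
  -- The factor vanishes outside the ball of radius `2 R`, so it suffices that one point is inside.
  have key : ∀ x y, ‖x‖ ≤ 2 * R → ‖c x • v x - c y • v y‖ ≤ (L + R⁻¹ * M) * ‖x - y‖ := by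
    intro x y hx
    have hxy : ‖(c x - c y) • v x‖ ≤ R⁻¹ * M * ‖x - y‖ := by
      rw [norm_smul, Real.norm_eq_abs, mul_right_comm]
      exact mul_le_mul (hclip x y) (hvM x hx) (norm_nonneg _) (by positivity)
    rcases le_or_gt ‖y‖ (2 * R) with hy | hy
    · have h1 : c x • v x - c y • v y = c y • (v x - v y) + (c x - c y) • v x := by
        rw [smul_sub, sub_smul]; abel
      have h2 : ‖c y • (v x - v y)‖ ≤ L * ‖x - y‖ := by
        rw [norm_smul, Real.norm_of_nonneg (hc0 y)]
        calc c y * ‖v x - v y‖ ≤ 1 * ‖v x - v y‖ :=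
              mul_le_mul_of_nonneg_right (hc1 y) (norm_nonneg _)
          _ ≤ _ := by rw [one_mul]; exact hLv x y hx hy
      rw [h1, add_mul]
      exact (norm_add_le _ _).trans (add_le_add h2 hxy)
    · rw [hcout y hy] at hxy ⊢
      rw [sub_zero] at hxy
      rw [zero_smul, sub_zero, add_mul]
      exact hxy.trans (le_add_of_nonneg_left (by positivity))
  refine ⟨c, ⟨L + R⁻¹ * M, by positivity⟩, ⟨M, hM0⟩,
    LipschitzWith.of_dist_le_mul fun x y => ?_, fun x => ?_, hc0, fun x hx => ?_⟩
  · rw [dist_eq_norm, dist_eq_norm]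
    change _ ≤ (L + R⁻¹ * M) * _
    rcases le_or_gt ‖x‖ (2 * R) with hx | hx
    · exact key x y hx
    rcases le_or_gt ‖y‖ (2 * R) with hy | hy
    · rw [norm_sub_rev, norm_sub_rev x]
      exact key y x hy
    · rw [hcout x hx, hcout y hy]
      simp only [zero_smul, sub_zero, norm_zero]
      positivity
  · change _ ≤ M
    rcases le_or_gt ‖x‖ (2 * R) with hx | hx
    · rw [norm_smul, Real.norm_of_nonneg (hc0 x)]
      exact (mul_le_of_le_one_left (norm_nonneg _) (hc1 x)).trans (hvM x hx)
    · rw [hcout x hx, zero_smul, norm_zero]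
      exact hM0
  · have : ‖x‖ / R ≤ 1 := (div_le_one hR).2 hx
    change max 0 (min 1 (2 - ‖x‖ / R)) = 1
    rw [min_eq_left (by linarith), max_eq_right zero_le_one]

theorem exists_hasDerivWithinAt_Icc_of_lipschitzWith [CompleteSpace E] {w : E → E} {K M : ℝ≥0}
    (hw : LipschitzWith K w) (hM : ∀ x, ‖w x‖ ≤ M) (x₀ : E) {T : ℝ} (hT : 0 ≤ T) :
    ∃ α : ℝ → E, α 0 = x₀ ∧ ∀ t ∈ Icc 0 T, HasDerivWithinAt α (w (α t)) (Icc 0 T) t := by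
  have h : IsPicardLindelof (fun _ => w) (⟨0, left_mem_Icc.2 hT⟩ : Icc (0 : ℝ) T) x₀
      (M * ⟨T, hT⟩) 0 M K :=
    { lipschitzOnWith := fun t _ => hw.lipschitzOnWith
      continuousOn := fun x _ => continuousOn_const
      norm_le := fun t _ x _ => hM x
      mul_max_le := by
        change (M : ℝ) * max (T - 0) (0 - 0) ≤ M * T - 0
        rw [sub_zero, sub_zero, sub_zero, max_eq_left hT] }
  exact h.exists_eq_forall_mem_Icc_hasDerivWithinAt₀

theorem HasDerivWithinAt.Ici_of_Icc {α : ℝ → E} {α' : E} {T t : ℝ} (ht : t ∈ Ico 0 T)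
    (h : HasDerivWithinAt α α' (Icc 0 T) t) : HasDerivWithinAt α α' (Ici t) t :=
  (h.mono (Icc_subset_Icc_left ht.1)).mono_of_mem_nhdsWithin (Icc_mem_nhdsGE ht.2)

/-- Uniqueness on compact intervals: both curves stay in a common ball. -/
theorem LipschitzOnBalls.eqOn_Icc {v : E → E} (hv : LipschitzOnBalls v) {α β : ℝ → E} {T : ℝ}
    (hαc : ContinuousOn α (Icc 0 T)) (hβc : ContinuousOn β (Icc 0 T))
    (hα : ∀ t ∈ Ico 0 T, HasDerivWithinAt α (v (α t)) (Ici t) t)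
    (hβ : ∀ t ∈ Ico 0 T, HasDerivWithinAt β (v (β t)) (Ici t) t) (h0 : α 0 = β 0) :
    EqOn α β (Icc 0 T) := by
  obtain ⟨A, hA⟩ := isCompact_Icc.exists_bound_of_continuousOn hαc
  obtain ⟨B, hB⟩ := isCompact_Icc.exists_bound_of_continuousOn hβc
  obtain ⟨K, hK⟩ := hv.lipschitzOnWith (R := max (max A B) 1) (lt_max_of_lt_right one_pos)
  refine ODE_solution_unique_of_mem_Icc_right (v := fun _ => v)
    (s := fun _ => Metric.closedBall 0 (max (max A B) 1)) (fun t _ => hK) hαc hα (fun t ht => ?_)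
    hβc hβ (fun t ht => ?_) h0 <;> rw [mem_closedBall_zero_iff]
  · exact (hA t (Ico_subset_Icc_self ht)).trans ((le_max_left _ _).trans (le_max_left _ _))
  · exact (hB t (Ico_subset_Icc_self ht)).trans ((le_max_right _ _).trans (le_max_left _ _))

theorem HasDerivWithinAt.quadratic {B : E →L[ℝ] E →L[ℝ] ℝ} (hB : ∀ x y, B x y = B y x)
    {α : ℝ → E} {α' : E} {s : Set ℝ} {t : ℝ} (h : HasDerivWithinAt α α' s t) :
    HasDerivWithinAt (fun t => B (α t) (α t)) (2 * B (α t) α') s t := by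
  have h1 := (B.hasFDerivAt.comp_hasDerivWithinAt t h).clm_apply h
  rw [hB α' (α t)] at h1
  rwa [two_mul]

/-- Exponential decay of a quadratic form along solutions. -/
theorem quadratic_le_exp {B : E →L[ℝ] E →L[ℝ] ℝ} (hB : ∀ x y, B x y = B y x) {w : E → E} {κ : ℝ}
    (hw : ∀ x, 2 * B x (w x) ≤ -κ * B x x) {α : ℝ → E} {T : ℝ} (hαc : ContinuousOn α (Icc 0 T))
    (hα : ∀ t ∈ Ico 0 T, HasDerivWithinAt α (w (α t)) (Ici t) t) {t : ℝ} (ht : t ∈ Icc 0 T) :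
    B (α t) (α t) ≤ B (α 0) (α 0) * Real.exp (-κ * t) := by
  have hc : ContinuousOn (fun t => B (α t) (α t)) (Icc 0 T) :=
    (B.continuous.comp_continuousOn hαc).clm_apply hαc
  have := le_gronwallBound_of_liminf_deriv_right_le (f' := fun t => 2 * B (α t) (w (α t))) hc
    (fun s hs r hr => ((hα s hs).quadratic hB).liminf_right_slope_le hr) le_rfl
    (fun s _ => by rw [add_zero]; exact hw (α s)) t ht
  rwa [gronwallBound_ε0, sub_zero] at this

/-- A globally defined solution in differential form. The field is first damped outside a ball that
contains the sublevel set of the initial state; the damping does not affect the sign of the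
derivative of the quadratic form, so the solution never leaves the ball. -/
theorem exists_global_solution [CompleteSpace E] {v : E → E} (hv : LipschitzOnBalls v)
    {B : E →L[ℝ] E →L[ℝ] ℝ} (hB : ∀ x y, B x y = B y x) {αlo κ : ℝ} (hlo : 0 < αlo)
    (hκ : 0 ≤ κ) (hBlo : ∀ x, αlo * ‖x‖ ^ 2 ≤ B x x)
    (hdec : ∀ x, 2 * B x (v x) ≤ -κ * B x x) (x₀ : E) :
    ∃ ξ : ℝ → E, ξ 0 = x₀ ∧ ContinuousOn ξ (Ici 0) ∧
      ∀ t, 0 ≤ t → HasDerivWithinAt ξ (v (ξ t)) (Ici t) t := by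
  have hBpos : ∀ x, 0 ≤ B x x := fun x => (by positivity : 0 ≤ αlo * ‖x‖ ^ 2).trans (hBlo x)
  have hT : ∀ T : ℝ, 0 ≤ T → ∃ α : ℝ → E, α 0 = x₀ ∧
      ∀ t ∈ Icc 0 T, HasDerivWithinAt α (v (α t)) (Icc 0 T) t := by
    intro T hT
    set R := √(B x₀ x₀ / αlo) + 1 with hR
    obtain ⟨c, K, M, hK, hM, hc0, hc1⟩ := hv.exists_cutoff (R := R) (by positivity)
    obtain ⟨α, hα0, hα⟩ := exists_hasDerivWithinAt_Icc_of_lipschitzWith hK hM x₀ hT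
    refine ⟨α, hα0, fun t ht => ?_⟩
    have h1 := quadratic_le_exp hB (w := fun x => c x • v x) (κ := 0) (fun x => by
      have h2 : B x (v x) ≤ 0 := by nlinarith [hdec x, mul_nonneg hκ (hBpos x)]
      rw [map_smul, smul_eq_mul]
      nlinarith [mul_nonneg (hc0 x) (neg_nonneg.2 h2)])
      (fun s hs => (hα s hs).continuousWithinAt)
      (fun s hs => (hα s (Ico_subset_Icc_self hs)).Ici_of_Icc hs) ht
    rw [neg_zero, zero_mul, Real.exp_zero, mul_one, hα0] at h1
    have h2 : ‖α t‖ ≤ R := by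
      have h3 : ‖α t‖ ^ 2 ≤ B x₀ x₀ / αlo := by
        rw [le_div_iff₀ hlo, mul_comm]
        exact (hBlo _).trans h1
      exact (Real.le_sqrt_of_sq_le h3).trans (le_add_of_nonneg_right zero_le_one)
    have h3 := hα t ht
    rwa [hc1 _ h2, one_smul] at h3
  choose! α hα0 hα using hT
  have hagree : ∀ T, 0 ≤ T → EqOn (fun t => α t t) (α T) (Icc 0 T) := by
    intro T hT t ht
    have hsub : Icc 0 t ⊆ Icc 0 T := Icc_subset_Icc_right ht.2
    exact hv.eqOn_Icc (fun s hs => (hα t ht.1 s hs).continuousWithinAt)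
      (fun s hs => ((hα T hT s (hsub hs)).mono hsub).continuousWithinAt)
      (fun s hs => (hα t ht.1 s (Ico_subset_Icc_self hs)).Ici_of_Icc hs)
      (fun s hs => (hα T hT s (hsub (Ico_subset_Icc_self hs))).Ici_of_Icc
        ⟨hs.1, hs.2.trans_le ht.2⟩)
      ((hα0 t ht.1).trans (hα0 T hT).symm) (right_mem_Icc.2 ht.1)
  have hd : ∀ T, 0 ≤ T → ∀ t ∈ Icc 0 T,
      HasDerivWithinAt (fun t => α t t) (v (α t t)) (Icc 0 T) t := fun T hT t ht => by
    have := hagree T hT ht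
    simp only at this
    rw [this]
    exact (hα T hT t ht).congr (hagree T hT) (hagree T hT ht)
  refine ⟨fun t => α t t, hα0 0 le_rfl, fun t ht => ?_, fun t ht => ?_⟩
  · have ht' : t < t + 1 := lt_add_one t
    have ht0 : (0 : ℝ) ≤ t := ht
    refine ((hd (t + 1) (by linarith) t ⟨ht, ht'.le⟩).continuousWithinAt).mono_of_mem_nhdsWithin ?_
    exact mem_nhdsWithin.2 ⟨Iio (t + 1), isOpen_Iio, ht', fun s hs => ⟨hs.2, hs.1.le⟩⟩
  · exact (hd (t + 1) (by linarith) t ⟨ht, by linarith⟩).Ici_of_Icc ⟨ht, by linarith⟩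

theorem IsSolution.hasDerivWithinAt [CompleteSpace E] {v : E → E} {x₀ : E} {b : EReal}
    {ξ : ℝ → E} (h : IsSolution v x₀ b ξ) {t : ℝ} (ht : t ∈ lifeSpan b) :
    HasDerivWithinAt ξ (v (ξ t)) (Ici t) t := by
  obtain ⟨-, hc, hint⟩ := h
  obtain ⟨T, htT, hTb⟩ := EReal.lt_iff_exists_real_btwn.1 ht.2
  rw [EReal.coe_lt_coe_iff] at htT
  have hsub : Icc 0 T ⊆ lifeSpan b := fun s hs =>
    ⟨hs.1, (EReal.coe_le_coe_iff.2 hs.2).trans_lt hTb⟩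
  have hcT := hc.mono hsub
  have hnhds : Icc 0 T ∈ 𝓝[>] t :=
    Filter.mem_of_superset (Ioc_mem_nhdsGT htT) fun s hs => ⟨ht.1.trans hs.1.le, hs.2⟩
  have h1 : HasDerivWithinAt (fun u => ∫ s in (0 : ℝ)..u, v (ξ s)) (v (ξ t)) (Ici t) t := by
    refine intervalIntegral.integral_hasDerivWithinAt_right (t := Ioi t) ?_ ?_ ?_
    · refine (hcT.mono ?_).intervalIntegrable
      rw [uIcc_of_le ht.1]
      exact Icc_subset_Icc_right htT.le
    · exact ⟨Icc 0 T, hnhds, hcT.aestronglyMeasurable measurableSet_Icc⟩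
    · exact (hcT t ⟨ht.1, htT.le⟩).mono_of_mem_nhdsWithin hnhds
  refine (h1.const_add x₀).congr_of_eventuallyEq ?_ (hint t ht)
  filter_upwards [Icc_mem_nhdsGE htT] with s hs
  exact hint s (hsub ⟨ht.1.trans hs.1, hs.2⟩)

/-- A solution in differential form on `[0, ∞)` is the unique maximal solution. -/
theorem isMaximalSolution_top [CompleteSpace E] {v : E → E} (hv : LipschitzOnBalls v) {ξ : ℝ → E}
    (hξc : ContinuousOn ξ (Ici 0)) (hξ : ∀ t, 0 ≤ t → HasDerivWithinAt ξ (v (ξ t)) (Ici t) t) :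
    IsMaximalSolution v (ξ 0) ⊤ ξ := by
  have hlife : lifeSpan ⊤ = Ici 0 := by
    ext t
    simp [lifeSpan]
  have hvc : ContinuousOn (fun s => v (ξ s)) (Ici 0) := hv.continuous.comp_continuousOn hξc
  refine ⟨EReal.zero_lt_top, ⟨by rwa [hlife], by rwa [hlife], fun t ht => ?_⟩,
    fun b' ξ' h' => ⟨le_top, fun t ht => ?_⟩⟩
  · have ht0 : 0 ≤ t := ht.1
    have hsub : uIcc 0 t ⊆ Ici 0 := by
      rw [uIcc_of_le ht0]
      exact Icc_subset_Ici_self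
    rw [intervalIntegral.integral_eq_sub_of_hasDeriv_right (hξc.mono hsub) (fun s hs => ?_)
      (hvc.mono hsub).intervalIntegrable]
    · abel
    · rw [min_eq_left ht0] at hs
      exact (hξ s hs.1.le).mono Ioi_subset_Ici_self
  · have hsub : Icc 0 t ⊆ lifeSpan b' := fun s hs =>
      ⟨hs.1, (EReal.coe_le_coe_iff.2 hs.2).trans_lt ht.2⟩
    refine hv.eqOn_Icc (h'.1.mono hsub) (hξc.mono Icc_subset_Ici_self)
      (fun s hs => h'.hasDerivWithinAt (hsub (Ico_subset_Icc_self hs))) (fun s hs => hξ s hs.1) ?_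
      (right_mem_Icc.2 ht.1)
    have := h'.2.2 0 (hsub (left_mem_Icc.2 ht.1))
    rwa [intervalIntegral.integral_same, add_zero] at this

/-- A quadratic form that decreases at rate `κ` along a locally Lipschitz field is a control
Lyapunov function. -/
theorem isCLF_of_quadratic [CompleteSpace E] {v : E → E} (hv : LipschitzOnBalls v)
    {B : E →L[ℝ] E →L[ℝ] ℝ} (hB : ∀ x y, B x y = B y x) {αlo αhi κ : ℝ} (hlo : 0 < αlo)
    (hhi : 0 < αhi) (hκ : 0 < κ) (hBlo : ∀ x, αlo * ‖x‖ ^ 2 ≤ B x x)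
    (hBhi : ∀ x, B x x ≤ αhi * ‖x‖ ^ 2) (hdec : ∀ x, 2 * B x (v x) ≤ -κ * B x x) :
    IsCLF v (fun x => B x x) αlo αhi κ := by
  refine ⟨hlo, hhi, hκ, B.continuous.clm_apply continuous_id, fun x => ⟨hBlo x, hBhi x⟩,
    fun x => ?_⟩
  obtain ⟨ξ, rfl, hc, hd⟩ := exists_global_solution hv hB hlo hκ.le hBlo hdec x
  refine ⟨⊤, ξ, isMaximalSolution_top hv hc hd, ?_⟩
  rw [diniAtZero_eq_of_hasDerivWithinAt ((hd 0 le_rfl).quadratic hB), EReal.coe_le_coe_iff]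
  exact hdec _

theorem isClassKL_exp {C κ : ℝ} (hC : 0 < C) (hκ : 0 < κ) :
    IsClassKL fun r s => C.toNNReal * r * (Real.exp (-κ * s)).toNNReal := by
  have hC' : 0 < C.toNNReal := Real.toNNReal_pos.2 hC
  have he : ∀ s : ℝ≥0, 0 < (Real.exp (-κ * s)).toNNReal := fun s =>
    Real.toNNReal_pos.2 (Real.exp_pos _)
  refine ⟨fun s => ⟨by fun_prop, fun r r' h => ?_, by simp⟩, fun r hr => ⟨fun s s' h => ?_, ?_⟩⟩
  · exact mul_lt_mul_of_pos_right (mul_lt_mul_of_pos_left h hC') (he s)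
  · refine mul_lt_mul_of_pos_left ?_ (mul_pos hC' hr)
    rw [Real.toNNReal_lt_toNNReal_iff (Real.exp_pos _), Real.exp_lt_exp, neg_mul, neg_mul,
      neg_lt_neg_iff]
    exact mul_lt_mul_of_pos_left (by exact_mod_cast h) hκ
  · have h1 : Filter.Tendsto (fun s : ℝ≥0 => Real.exp (-κ * s)) Filter.atTop (𝓝 0) := by
      refine Real.tendsto_exp_atBot.comp ?_
      exact (NNReal.tendsto_coe_atTop.2 Filter.tendsto_id).const_mul_atTop_of_neg
        (neg_neg_of_pos hκ)
    have h2 := (tendsto_real_toNNReal h1).const_mul (C.toNNReal * r)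
    simpa using h2

theorem isUGAS_of_quadratic [CompleteSpace E] {v : E → E} (hv : LipschitzOnBalls v)
    {B : E →L[ℝ] E →L[ℝ] ℝ} (hB : ∀ x y, B x y = B y x) {αlo αhi κ : ℝ} (hlo : 0 < αlo)
    (hhi : 0 < αhi) (hκ : 0 < κ) (hBlo : ∀ x, αlo * ‖x‖ ^ 2 ≤ B x x)
    (hBhi : ∀ x, B x x ≤ αhi * ‖x‖ ^ 2) (hdec : ∀ x, 2 * B x (v x) ≤ -κ * B x x) :
    IsUGAS v := by
  refine ⟨_, isClassKL_exp (C := √(αhi / αlo)) (κ := κ / 2) (by positivity) (by positivity),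
    fun x₀ => ?_⟩
  obtain ⟨ξ, rfl, hc, hd⟩ := exists_global_solution hv hB hlo hκ.le hBlo hdec x₀
  refine ⟨ξ, isMaximalSolution_top hv hc hd, fun t => ?_⟩
  rw [← NNReal.coe_le_coe]
  push_cast
  rw [Real.coe_toNNReal _ (Real.sqrt_nonneg _), Real.coe_toNNReal _ (Real.exp_pos _).le]
  refine le_of_sq_le_sq ?_ (by positivity)
  have h1 := quadratic_le_exp hB hdec (T := t) (hc.mono Icc_subset_Ici_self)
    (fun s hs => hd s hs.1) (right_mem_Icc.2 t.2)
  have h2 : αlo * ‖ξ t‖ ^ 2 ≤ αhi * ‖ξ 0‖ ^ 2 * Real.exp (-κ * t) :=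
    (hBlo _).trans (h1.trans (mul_le_mul_of_nonneg_right (hBhi _) (Real.exp_pos _).le))
  rw [mul_pow, mul_pow, Real.sq_sqrt (by positivity), ← Real.exp_nat_mul]
  rw [← le_div_iff₀' hlo] at h2
  refine h2.trans (le_of_eq ?_)
  rw [show ((2 : ℕ) : ℝ) * (-(κ / 2) * t) = -κ * t by push_cast; ring]
  ring

end LyapunovTheory

/-! ### Regularity of the closed loop -/

section SquareSummable

variable {F : ℕ → Type*} [∀ i, NormedAddCommGroup (F i)]

theorem hasSum_norm_sq_lp_two (x : lp F 2) : HasSum (fun i => ‖x i‖ ^ 2) (‖x‖ ^ 2) := by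
  simpa using lp.hasSum_norm (by simp) x

theorem memℓp_two_iff {x : ∀ i, F i} : Memℓp x 2 ↔ Summable fun i => ‖x i‖ ^ 2 := by
  simpa using memℓp_gen_iff (f := x) (p := 2) (by simp)

/-- Closed graph theorem for maps into `ℓ²`: continuity of the coordinates is enough. -/
theorem LinearMap.continuous_of_continuous_coord [∀ i, NormedSpace ℝ (F i)]
    [∀ i, CompleteSpace (F i)] {E : Type*} [NormedAddCommGroup E] [NormedSpace ℝ E]
    [CompleteSpace E] (T : E →ₗ[ℝ] lp F 2) (hT : ∀ i, Continuous fun x => T x i) :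
    Continuous T := by
  refine T.continuous_of_seq_closed_graph fun u x y hu hTu => ?_
  ext i
  have h1 := ((lp.evalCLM ℝ F 2 i).continuous.tendsto y).comp hTu
  exact tendsto_nhds_unique h1 (((hT i).tendsto x).comp hu)

end SquareSummable

namespace Network

open Matrix

variable {S : Network}

theorem f_zero (i : ℕ) : S.f i 0 = 0 := by
  have h := S.f_eq i 0
  rw [WithLp.ofLp_zero, mulVec_zero, mulVec_zero] at h
  exact (WithLp.ofLp_injective 2) h

theorem adv_zero (i : ℕ) : S.adv (fun _ => 0) i = 0 := rfl

theorem continuous_adv (i : ℕ) : Continuous fun x : S.X => S.adv (fun j => x j) i :=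
  continuous_pi fun p => (EuclideanSpace.proj (𝕜 := ℝ) p.2).continuous.comp
    (lp.evalCLM ℝ (fun i => S.St i) 2 p.1).continuous

/-- The coupling `x ↦ (D_i w_i)_i` is a bounded operator on `ℓ²`. It maps `ℓ²` to `ℓ²` because the
network with zero input and the drift do. -/
theorem exists_couplingCLM (hLip : S.UniformlyLipschitz) (hX : S.MapsIntoX) :
    ∃ T : S.X →L[ℝ] S.X, ∀ x i, T x i = WithLp.toLp 2 (S.D i *ᵥ S.adv (fun j => x j) i) := by
  have hmem : ∀ x : S.X,
      Memℓp (fun i => (WithLp.toLp 2 (S.D i *ᵥ S.adv (fun j => x j) i) : S.St i)) 2 := by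
    intro x
    obtain ⟨L, hL, h⟩ := hLip (‖x‖ + 1) (by positivity)
    have hf : Memℓp (fun i => S.f i (x i)) 2 := by
      rw [memℓp_two_iff]
      refine ((hasSum_norm_sq_lp_two x).summable.mul_left (L ^ 2)).of_nonneg_of_le
        (fun i => sq_nonneg _) fun i => ?_
      have h1 := (h i (x i) 0 ((lp.norm_apply_le_norm two_ne_zero x i).trans (by linarith))
        (by rw [norm_zero]; positivity)).1
      rw [f_zero, sub_zero, sub_zero] at h1
      rw [← mul_pow]
      exact pow_le_pow_left₀ (norm_nonneg _) h1 2
    convert (hX x 0).sub hf using 1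
    ext1 i
    simp [field, subField]
  let T : S.X →ₗ[ℝ] S.X :=
    { toFun := fun x => ⟨_, hmem x⟩
      map_add' := fun x y => by
        ext i : 2
        change WithLp.toLp 2 (S.D i *ᵥ (S.adv (fun j => x j) i + S.adv (fun j => y j) i)) = _
        rw [mulVec_add]
        rfl
      map_smul' := fun r x => by
        ext i : 2
        change WithLp.toLp 2 (S.D i *ᵥ (r • S.adv (fun j => x j) i)) = _
        rw [mulVec_smul]
        rfl }
  refine ⟨⟨T, T.continuous_of_continuous_coord fun i => ?_⟩, fun x i => rfl⟩
  exact (PiLp.continuous_toLp 2 _).comp (continuous_const.matrix_mulVec (continuous_adv i))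

/-- The input map at the origin `u ↦ (g_i(0) u_i)_i` is a bounded operator from `U` to `X`. -/
theorem exists_inputCLM (hX : S.MapsIntoX) :
    ∃ T : S.U →L[ℝ] S.X, ∀ u i, T u i = WithLp.toLp 2 (S.g i 0 *ᵥ (u i).ofLp) := by
  have hmem : ∀ u : S.U,
      Memℓp (fun i => (WithLp.toLp 2 (S.g i 0 *ᵥ (u i).ofLp) : S.St i)) 2 := by
    intro u
    convert hX 0 u using 1
    ext1 i
    simp [field, subField, f_zero, adv_zero]
  let T : S.U →ₗ[ℝ] S.X :=
    { toFun := fun u => ⟨_, hmem u⟩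
      map_add' := fun x y => by
        ext i : 2
        change WithLp.toLp 2 (S.g i 0 *ᵥ ((x i).ofLp + (y i).ofLp)) = _
        rw [mulVec_add]
        rfl
      map_smul' := fun r x => by
        ext i : 2
        change WithLp.toLp 2 (S.g i 0 *ᵥ (r • (x i).ofLp)) = _
        rw [mulVec_smul]
        rfl }
  refine ⟨⟨T, T.continuous_of_continuous_coord fun i => ?_⟩, fun x i => rfl⟩
  have h1 : Continuous fun u : S.U => (u i).ofLp :=
    (PiLp.continuous_ofLp 2 _).comp (lp.evalCLM ℝ (fun i => S.In i) 2 i).continuous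
  exact (PiLp.continuous_toLp 2 _).comp (continuous_const.matrix_mulVec h1)

theorem lipschitzOnBalls_closedLoop (hLip : S.UniformlyLipschitz) (hX : S.MapsIntoX)
    {K : S.X → S.U} (hK : Admissible K) : LipschitzOnBalls (closedLoop hX K) := by
  intro R hR
  obtain ⟨L, hL, hfg⟩ := hLip R hR
  obtain ⟨LK, hLK, hKR⟩ := hK R hR
  obtain ⟨D, hD⟩ := exists_couplingCLM hLip hX
  obtain ⟨G, hG⟩ := exists_inputCLM hX
  set M : ℝ := ‖K 0‖ + LK * R with hM
  have hMK : ∀ x : S.X, ‖x‖ ≤ R → ‖K x‖ ≤ M := fun x hx => by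
    have h1 := hKR x 0 hx (by simpa using hR.le)
    have h2 := norm_le_norm_add_norm_sub' (K x) (K 0)
    rw [sub_zero] at h1
    have h3 := mul_le_mul_of_nonneg_left hx hLK.le
    linarith
  set A : ℝ := L + L * M with hA
  refine ⟨√(4 * (A ^ 2 + (L * R) ^ 2 * LK ^ 2 + ‖G‖ ^ 2 * LK ^ 2 + ‖D‖ ^ 2)) + 1, by positivity,
    fun x y hx hy => ?_⟩
  have hcoord : ∀ i, ‖closedLoop hX K x i - closedLoop hX K y i‖ ≤ A * ‖(x - y) i‖
      + L * R * ‖(K x - K y) i‖ + ‖G (K x - K y) i‖ + ‖D (x - y) i‖ := by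
    intro i
    have hxi : ‖x i‖ ≤ R := (lp.norm_apply_le_norm two_ne_zero x i).trans hx
    have hyi : ‖y i‖ ≤ R := (lp.norm_apply_le_norm two_ne_zero y i).trans hy
    obtain ⟨h1, h2⟩ := hfg i (x i) (y i) hxi hyi
    have h3 := (hfg i (y i) 0 hyi (by rw [norm_zero]; exact hR.le)).2
    have hsplit : closedLoop hX K x i - closedLoop hX K y i
        = (S.f i (x i) - S.f i (y i))
          + WithLp.toLp 2 ((S.g i (x i) - S.g i (y i)) *ᵥ (K x i).ofLp)
          + WithLp.toLp 2 ((S.g i (y i) - S.g i 0) *ᵥ ((K x - K y) i).ofLp)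
          + G (K x - K y) i + D (x - y) i := by
      have e1 : D (x - y) i = D x i - D y i := by rw [map_sub]; rfl
      have e2 : (K x - K y) i = K x i - K y i := rfl
      rw [e1, hD, hD, hG, e2]
      simp only [closedLoop, field, subField, WithLp.ofLp_sub, sub_mulVec, mulVec_sub,
        WithLp.toLp_sub]
      abel
    have b1 := norm_toLp_mulVec_le (S.g i (x i) - S.g i (y i)) (K x i)
    have b2 := norm_toLp_mulVec_le (S.g i (y i) - S.g i 0) ((K x - K y) i)
    have c1 : specNorm (S.g i (x i) - S.g i (y i)) * ‖K x i‖ ≤ L * M * ‖x i - y i‖ := by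
      rw [mul_right_comm]
      exact mul_le_mul h2 ((lp.norm_apply_le_norm two_ne_zero _ i).trans (hMK x hx))
        (norm_nonneg _) (by positivity)
    have c2 : specNorm (S.g i (y i) - S.g i 0) * ‖(K x - K y) i‖ ≤ L * R * ‖(K x - K y) i‖ := by
      refine mul_le_mul_of_nonneg_right (h3.trans ?_) (norm_nonneg _)
      rw [sub_zero]
      exact mul_le_mul_of_nonneg_left hyi hL.le
    rw [hsplit]
    refine norm_add₄_le.trans (add_le_add_left (add_le_add_left (add_le_add
      ((norm_add_le _ _).trans ?_) (b2.trans c2)) _) _)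
    have e3 : ‖(x - y) i‖ = ‖x i - y i‖ := rfl
    rw [hA, add_mul, e3]
    exact add_le_add h1 (b1.trans c1)
  have hsq : ∀ i, ‖(closedLoop hX K x - closedLoop hX K y) i‖ ^ 2 ≤ 4 * (A ^ 2 * ‖(x - y) i‖ ^ 2
      + (L * R) ^ 2 * ‖(K x - K y) i‖ ^ 2 + ‖G (K x - K y) i‖ ^ 2 + ‖D (x - y) i‖ ^ 2) := by
    intro i
    have h4 : ∀ p q r s : ℝ, (p + q + r + s) ^ 2 ≤ 4 * (p ^ 2 + q ^ 2 + r ^ 2 + s ^ 2) := by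
      intro p q r s
      linarith [sq_nonneg (p - q), sq_nonneg (p - r), sq_nonneg (p - s), sq_nonneg (q - r),
        sq_nonneg (q - s), sq_nonneg (r - s)]
    refine (pow_le_pow_left₀ (norm_nonneg _) (hcoord i) 2).trans ((h4 _ _ _ _).trans (le_of_eq ?_))
    rw [mul_pow, mul_pow _ ‖(K x - K y) i‖]
  have hsum := hasSum_le hsq (hasSum_norm_sq_lp_two _)
    ((((((hasSum_norm_sq_lp_two (x - y)).mul_left (A ^ 2)).add
      ((hasSum_norm_sq_lp_two (K x - K y)).mul_left ((L * R) ^ 2))).add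
      (hasSum_norm_sq_lp_two (G (K x - K y)))).add
      (hasSum_norm_sq_lp_two (D (x - y)))).mul_left 4)
  have hKK : ‖K x - K y‖ ^ 2 ≤ LK ^ 2 * ‖x - y‖ ^ 2 := by
    rw [← mul_pow]
    exact pow_le_pow_left₀ (norm_nonneg _) (hKR x y hx hy) 2
  have hGG : ‖G (K x - K y)‖ ^ 2 ≤ ‖G‖ ^ 2 * (LK ^ 2 * ‖x - y‖ ^ 2) := by
    refine (pow_le_pow_left₀ (norm_nonneg _) (G.le_opNorm _) 2).trans ?_
    rw [mul_pow]
    exact mul_le_mul_of_nonneg_left hKK (sq_nonneg _)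
  have hDD : ‖D (x - y)‖ ^ 2 ≤ ‖D‖ ^ 2 * ‖x - y‖ ^ 2 := by
    rw [← mul_pow]
    exact pow_le_pow_left₀ (norm_nonneg _) (D.le_opNorm _) 2
  have hLR := mul_le_mul_of_nonneg_left hKK (sq_nonneg (L * R))
  set B : ℝ := 4 * (A ^ 2 + (L * R) ^ 2 * LK ^ 2 + ‖G‖ ^ 2 * LK ^ 2 + ‖D‖ ^ 2) with hB
  have hfin : ‖closedLoop hX K x - closedLoop hX K y‖ ^ 2 ≤ (√B * ‖x - y‖) ^ 2 := by
    rw [mul_pow, Real.sq_sqrt (by positivity), hB]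
    linarith
  refine (le_of_sq_le_sq hfin (by positivity)).trans ?_
  exact mul_le_mul_of_nonneg_right (le_add_of_nonneg_right zero_le_one) (norm_nonneg _)

end Network

namespace Design

open Matrix

variable {S : Network} {c : Design S}

theorem control_zero (i : ℕ) : c.control i 0 = 0 := by
  rw [control, WithLp.ofLp_zero, mulVec_zero, WithLp.toLp_zero]

theorem norm_sq_mul_le_V {ζlo : ℝ} {i : ℕ} (hP : (c.P i).PosDef) (hmin : ζlo ≤ lamMin (c.P i))
    (x : S.St i) : ζlo * ‖x‖ ^ 2 ≤ c.V i x := by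
  rw [← dotProduct_self_eq_norm_sq]
  exact (mul_le_mul_of_nonneg_right hmin (by simpa using dotProduct_star_self_nonneg x.ofLp)).trans
    (lamMin_mul_le hP _)

theorem V_le_mul_norm_sq {ζhi : ℝ} {i : ℕ} (hP : (c.P i).PosDef) (hmax : lamMax (c.P i) ≤ ζhi)
    (x : S.St i) : c.V i x ≤ ζhi * ‖x‖ ^ 2 := by
  rw [← dotProduct_self_eq_norm_sq]
  exact (le_lamMax_mul hP _).trans
    (mul_le_mul_of_nonneg_right hmax (by simpa using dotProduct_star_self_nonneg x.ofLp))

/-- Subsystems of dimension zero are excluded: their spectrum is empty and `lamMin` takes the junk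
value `0`. -/
theorem exists_norm_eq_one_of_lamMin_pos {i : ℕ} (h : 0 < lamMin (c.P i)) :
    ∃ e : S.St i, ‖e‖ = 1 := by
  have : Nonempty (Fin (S.n i)) := by
    by_contra hn
    rw [not_nonempty_iff] at hn
    rw [lamMin, spectrum.of_subsingleton, Real.sInf_empty] at h
    exact h.false
  exact exists_norm_eq (S.St i) zero_le_one

/-- The decay rates `κ_i` are bounded: the closed-loop field is Lipschitz on the unit ball of `ℓ²`,
and a state with a single nonzero coordinate does not feel the interconnection. -/
theorem exists_forall_kappa_le {hX : S.MapsIntoX} {d : Experiment S}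
    (hdata : ∀ i, c.FromData d i) {K : S.X → S.U} (hK : ∀ x i, K x i = c.control i (x i))
    (hv : LipschitzOnBalls (Network.closedLoop hX K)) {ζlo ζhi : ℝ} (hζlo : 0 < ζlo)
    (hmin : ∀ i, ζlo ≤ lamMin (c.P i)) (hmax : ∀ i, lamMax (c.P i) ≤ ζhi) :
    ∃ κhi : ℝ, ∀ i, c.κ i ≤ κhi := by
  obtain ⟨L, hL, h⟩ := hv 1 one_pos
  have h0 : Network.closedLoop hX K 0 = 0 := by
    ext i : 2
    have hK0 : K 0 i = 0 := by rw [hK]; exact control_zero i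
    change S.subField i 0 0 (K 0 i) = 0
    rw [hK0]
    simp [Network.subField, Network.f_zero]
  refine ⟨ζhi * (1 + L ^ 2) / ζlo, fun i => ?_⟩
  obtain ⟨e, he⟩ := exists_norm_eq_one_of_lamMin_pos (hζlo.trans_le (hmin i))
  have hP := (hdata i).2.1
  let x : S.X := lp.single 2 i e
  have hx : ‖x‖ = 1 := by rw [lp.norm_single (by simp), he]
  have hxi : x i = e := lp.single_apply_self 2 i e
  have hadv : S.adv (fun j => x j) i = 0 := by
    ext p
    have hp : (p.1 : ℕ) ≠ i := fun hp => by
      have hmem := p.1.2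
      rw [hp] at hmem
      exact S.notMem_nbr i hmem
    change x p.1 p.2 = 0
    have : x p.1 = 0 := lp.single_apply_ne 2 i e hp
    rw [this]
    rfl
  set y : S.St i := S.subField i e 0 (c.control i e) with hy
  have hyv : y = Network.closedLoop hX K x i := by
    change _ = S.subField i (x i) (S.adv (fun j => x j) i) (K x i)
    rw [hadv, hK, hxi]
  have hyL : ‖y‖ ≤ L := by
    have h1 := h x 0 hx.le (by simp)
    rw [h0, sub_zero, sub_zero, hx, mul_one] at h1
    rw [hyv]
    exact (lp.norm_apply_le_norm two_ne_zero _ i).trans h1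
  have h1 := (hdata i).dissipation e 0
  rw [dotProduct_zero, mul_zero, add_zero, ← hy] at h1
  have h2 := hP.posSemidef.dotProduct_mulVec_nonneg (e.ofLp + y.ofLp)
  simp only [star_trivial, mulVec_add, dotProduct_add, add_dotProduct,
    hP.dotProduct_mulVec_comm y.ofLp e.ofLp] at h2
  have h3 := V_le_mul_norm_sq hP (hmax i) e
  have h4 := V_le_mul_norm_sq hP (hmax i) y
  have h5 := norm_sq_mul_le_V hP (hmin i) e
  have h6 := (hdata i).2.2.1
  rw [he] at h3 h5
  have hζhi : 0 ≤ ζhi := by linarith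
  have h7 : ζhi * ‖y‖ ^ 2 ≤ ζhi * L ^ 2 :=
    mul_le_mul_of_nonneg_left (pow_le_pow_left₀ (norm_nonneg _) hyL 2) hζhi
  have h8 : c.κ i * ζlo ≤ c.κ i * c.V i e := mul_le_mul_of_nonneg_left (by linarith) h6.le
  rw [le_div_iff₀ hζlo]
  simp only [V] at h1 h3 h4 h8
  linarith

end Design

/-! ### The weighted sum of the local Lyapunov functions -/

/-- Pairing a subinvariant weight with a summable nonnegative sequence: the inequality `νᵀ a ≤ q νᵀ`
passes to `νᵀ a V ≤ q νᵀ V` after exchanging the two sums. -/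
theorem tsum_mul_tsum_le_of_subinvariant {ι κ : Type*} {a : ι → κ → ℝ} {ν : ι → ℝ} {η V : κ → ℝ}
    (ha : ∀ i j, 0 ≤ a i j) (hν : ∀ i, 0 ≤ ν i) (hV : ∀ j, 0 ≤ V j)
    (hcol : ∀ j, Summable (fun i => ν i * a i j) ∧ ∑' i, ν i * a i j ≤ η j)
    (hsum : Summable fun j => η j * V j) :
    Summable (fun i => ν i * ∑' j, a i j * V j) ∧
      ∑' i, ν i * ∑' j, a i j * V j ≤ ∑' j, η j * V j := by
  have hle : ∀ j, ∑' i, ν i * a i j * V j ≤ η j * V j := fun j => by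
    rw [tsum_mul_right]
    exact mul_le_mul_of_nonneg_right (hcol j).2 (hV j)
  have h0 : ∀ i j, 0 ≤ ν i * a i j * V j := fun i j =>
    mul_nonneg (mul_nonneg (hν i) (ha i j)) (hV j)
  have hout : Summable fun j => ∑' i, ν i * a i j * V j :=
    hsum.of_nonneg_of_le (fun j => tsum_nonneg fun i => h0 i j) hle
  have hprod : Summable fun p : κ × ι => ν p.2 * a p.2 p.1 * V p.1 :=
    (summable_prod_of_nonneg fun p => h0 p.2 p.1).2 ⟨fun j => (hcol j).1.mul_right (V j), hout⟩
  have hprod' : Summable fun p : ι × κ => ν p.1 * a p.1 p.2 * V p.2 := hprod.prod_symm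
  have hrow : ∀ i, ∑' j, ν i * a i j * V j = ν i * ∑' j, a i j * V j := fun i => by
    rw [← tsum_mul_left]
    simp only [mul_assoc]
  have hcomm : ∑' i, ∑' j, ν i * a i j * V j = ∑' j, ∑' i, ν i * a i j * V j :=
    hprod.tsum_comm (f := fun j i => ν i * a i j * V j)
  have h1 := hprod'.prod
  simp only [hrow] at h1 hcomm
  refine ⟨h1, ?_⟩
  rw [hcomm]
  exact hout.tsum_le_tsum hle hsum

section Bilinear

open Matrix

theorem abs_dotProduct_mulVec_le {a : Type} [Fintype a] [DecidableEq a] {P : Matrix a a ℝ}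
    (hP : P.PosDef) {ζ : ℝ} (hζ : lamMax P ≤ ζ) (x y : EuclideanSpace ℝ a) :
    |x.ofLp ⬝ᵥ P *ᵥ y.ofLp| ≤ ζ * (‖x‖ * ‖y‖) := by
  rcases eq_or_ne x 0 with rfl | hx
  · simp
  rcases eq_or_ne y 0 with rfl | hy
  · simp
  have hq : ∀ z : EuclideanSpace ℝ a, z.ofLp ⬝ᵥ P *ᵥ z.ofLp ≤ ζ * ‖z‖ ^ 2 := fun z => by
    rw [← dotProduct_self_eq_norm_sq]
    exact (le_lamMax_mul hP _).trans
      (mul_le_mul_of_nonneg_right hζ (by simpa using dotProduct_star_self_nonneg z.ofLp))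
  have hxy : 0 < ‖x‖ * ‖y‖ := mul_pos (norm_pos_iff.2 hx) (norm_pos_iff.2 hy)
  have h1 := hP.posSemidef.dotProduct_mulVec_nonneg (‖y‖ • x.ofLp - ‖x‖ • y.ofLp)
  have h2 := hP.posSemidef.dotProduct_mulVec_nonneg (‖y‖ • x.ofLp + ‖x‖ • y.ofLp)
  simp only [star_trivial, mulVec_sub, mulVec_add, mulVec_smul, dotProduct_sub, sub_dotProduct,
    dotProduct_add, add_dotProduct, dotProduct_smul, smul_dotProduct, smul_eq_mul,
    hP.dotProduct_mulVec_comm y.ofLp x.ofLp] at h1 h2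
  have h3 := mul_le_mul_of_nonneg_left (hq x) (sq_nonneg ‖y‖)
  have h4 := mul_le_mul_of_nonneg_left (hq y) (sq_nonneg ‖x‖)
  rw [abs_le]
  constructor <;> refine le_of_mul_le_mul_left ?_ hxy <;> linarith

/-- A weighted sum of uniformly bounded quadratic forms is a bounded bilinear form on `ℓ²`. -/
theorem exists_weightedForm {n : ℕ → ℕ} {P : ∀ i, Matrix (Fin (n i)) (Fin (n i)) ℝ}
    (hP : ∀ i, (P i).PosDef) {ζ : ℝ} (hζ : ∀ i, lamMax (P i) ≤ ζ) (hζ0 : 0 ≤ ζ) {μ : ℕ → ℝ} {C : ℝ}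
    (hμ : ∀ i, |μ i| ≤ C) :
    ∃ B : lp (fun i => EuclideanSpace ℝ (Fin (n i))) 2 →L[ℝ]
        lp (fun i => EuclideanSpace ℝ (Fin (n i))) 2 →L[ℝ] ℝ,
      (∀ x y, B x y = B y x) ∧
      ∀ x y, HasSum (fun i => μ i * ((x i).ofLp ⬝ᵥ P i *ᵥ (y i).ofLp)) (B x y) := by
  have hC : 0 ≤ C := (abs_nonneg _).trans (hμ 0)
  let t : lp (fun i => EuclideanSpace ℝ (Fin (n i))) 2 →
      lp (fun i => EuclideanSpace ℝ (Fin (n i))) 2 → ℕ → ℝ :=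
    fun x y i => μ i * ((x i).ofLp ⬝ᵥ P i *ᵥ (y i).ofLp)
  have hbound : ∀ x y i, ‖t x y i‖ ≤ C * ζ * (‖x i‖ * ‖y i‖) := fun x y i => by
    rw [Real.norm_eq_abs, abs_mul, mul_assoc]
    exact mul_le_mul (hμ i) (abs_dotProduct_mulVec_le (hP i) (hζ i) _ _) (abs_nonneg _) hC
  have hholder := fun x y : lp (fun i => EuclideanSpace ℝ (Fin (n i))) 2 =>
    lp.tsum_mul_le_mul_norm (p := 2) (q := 2) (by simpa using Real.HolderConjugate.two_two) x y
  have hs : ∀ x y, Summable (t x y) := fun x y =>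
    ((hholder x y).1.mul_left (C * ζ)).of_norm_bounded (hbound x y)
  let b := LinearMap.mk₂ ℝ (fun x y => ∑' i, t x y i)
    (fun x x' y => by
      rw [← (hs x y).tsum_add (hs x' y)]
      refine tsum_congr fun i => ?_
      change μ i * (((x i).ofLp + (x' i).ofLp) ⬝ᵥ _) = _
      rw [add_dotProduct, mul_add])
    (fun r x y => by
      rw [smul_eq_mul, ← tsum_mul_left]
      refine tsum_congr fun i => ?_
      change μ i * ((r • (x i).ofLp) ⬝ᵥ _) = r * (μ i * _)
      rw [smul_dotProduct, smul_eq_mul, mul_left_comm])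
    (fun x y y' => by
      rw [← (hs x y).tsum_add (hs x y')]
      refine tsum_congr fun i => ?_
      change μ i * (_ ⬝ᵥ P i *ᵥ ((y i).ofLp + (y' i).ofLp)) = _
      rw [mulVec_add, dotProduct_add, mul_add])
    (fun r x y => by
      rw [smul_eq_mul, ← tsum_mul_left]
      refine tsum_congr fun i => ?_
      change μ i * (_ ⬝ᵥ P i *ᵥ (r • (y i).ofLp)) = r * (μ i * _)
      rw [mulVec_smul, dotProduct_smul, smul_eq_mul, mul_left_comm])
  refine ⟨b.mkContinuous₂ (C * ζ) fun x y => ?_, fun x y => ?_, fun x y => (hs x y).hasSum⟩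
  · have h1 := tsum_of_norm_bounded ((hholder x y).1.mul_left (C * ζ)).hasSum (hbound x y)
    rw [tsum_mul_left] at h1
    rw [mul_assoc]
    exact h1.trans (mul_le_mul_of_nonneg_left (hholder x y).2 (mul_nonneg hC hζ0))
  · change ∑' i, t x y i = ∑' i, t y x i
    refine tsum_congr fun i => ?_
    simp only [t, (hP i).dotProduct_mulVec_comm (x i).ofLp]

end Bilinear

namespace Design

open Matrix

variable {S : Network} {c : Design S}

theorem V_nonneg {i : ℕ} (hP : (c.P i).PosDef) (x : S.St i) : 0 ≤ c.V i x := by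
  have h := hP.posSemidef.dotProduct_mulVec_nonneg x.ofLp
  rwa [star_trivial] at h

theorem gain_nonneg {d : Experiment S} (hdata : ∀ i, c.FromData d i)
    (hmin : ∀ i, 0 < lamMin (c.P i)) (i j : ℕ) : 0 ≤ c.gain i j := by
  rw [gain, Θ]
  have h1 := (hdata i).rho_nonneg
  have h2 := (hdata i).2.2.1
  have h3 := hmin j
  split_ifs <;> positivity

/-- The interconnection term of subsystem `i` is dominated by the gains applied to the `V_j`. -/
theorem rho_mul_adv_le {d : Experiment S} (hdata : ∀ i, c.FromData d i)
    (hmin : ∀ i, 0 < lamMin (c.P i)) (x : ∀ i, S.St i) (i : ℕ) :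
    c.ρ i * (S.adv x i ⬝ᵥ S.adv x i) ≤ c.κ i * ∑' j, c.gain i j * c.V j (x j) := by
  have h1 : S.adv x i ⬝ᵥ S.adv x i = ∑ j ∈ S.nbr i, ‖x j‖ ^ 2 := by
    rw [dotProduct, Fintype.sum_sigma, ← Finset.sum_coe_sort (S.nbr i)]
    exact Finset.sum_congr rfl fun j _ => dotProduct_self_eq_norm_sq (x j)
  have h2 : ∑' j, c.gain i j * c.V j (x j) = ∑ j ∈ S.nbr i, c.gain i j * c.V j (x j) :=
    tsum_eq_sum fun j hj => by simp [gain, Θ, hj]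
  have hκ := (hdata i).2.2.1
  rw [h1, h2, Finset.mul_sum, Finset.mul_sum]
  refine Finset.sum_le_sum fun j hj => ?_
  have h3 := norm_sq_mul_le_V (hdata j).2.1 le_rfl (x j)
  have h4 : c.κ i * (c.gain i j * c.V j (x j)) = c.ρ i * (c.V j (x j) / lamMin (c.P j)) := by
    rw [gain, Θ, if_pos hj]
    field_simp
  rw [h4]
  refine mul_le_mul_of_nonneg_left ?_ (hdata i).rho_nonneg
  rwa [le_div_iff₀' (hmin j)]

/-- With weights `μ_i = ν_i / κ_i`, where `ν` is subinvariant under the gain operator, the local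
dissipation inequalities add up to the decay of `∑ μ_i V_i` at rate `(1 - q) inf κ_i`. -/
theorem weightedForm_decay {hX : S.MapsIntoX} {d : Experiment S}
    (hdata : ∀ i, c.FromData d i) {K : S.X → S.U} (hK : ∀ x i, K x i = c.control i (x i))
    (hmin : ∀ i, 0 < lamMin (c.P i)) {ν : ℕ → ℝ} {C κlo q : ℝ} (hν0 : ∀ i, 0 ≤ ν i)
    (hνC : ∀ i, ν i ≤ C) {ζhi : ℝ} (hmax : ∀ i, lamMax (c.P i) ≤ ζhi) (hq : q ≤ 1)
    (hκ : ∀ i, κlo ≤ c.κ i)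
    (hcol : ∀ j, Summable (fun i => ν i * c.gain i j) ∧ ∑' i, ν i * c.gain i j ≤ q * ν j)
    {B : S.X →L[ℝ] S.X →L[ℝ] ℝ}
    (hB : ∀ x y, HasSum (fun i => ν i / c.κ i * ((x i).ofLp ⬝ᵥ c.P i *ᵥ (y i).ofLp)) (B x y))
    (x : S.X) : 2 * B x (Network.closedLoop hX K x) ≤ -((1 - q) * κlo) * B x x := by
  have hV0 : ∀ i, 0 ≤ c.V i (x i) := fun i => V_nonneg (hdata i).2.1 _
  have hνV : Summable fun i => ν i * c.V i (x i) := by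
    refine ((hasSum_norm_sq_lp_two x).summable.mul_left (C * ζhi)).of_nonneg_of_le
      (fun i => mul_nonneg (hν0 i) (hV0 i)) fun i => ?_
    rw [mul_assoc]
    exact mul_le_mul (hνC i) (V_le_mul_norm_sq (hdata i).2.1 (hmax i) (x i)) (hV0 i)
      ((hν0 i).trans (hνC i))
  obtain ⟨hs, hle⟩ := tsum_mul_tsum_le_of_subinvariant (gain_nonneg hdata hmin) hν0 hV0 hcol
    (by simpa only [mul_assoc] using hνV.mul_left q)
  simp only [mul_assoc, tsum_mul_left] at hle
  have hterm : ∀ i, 2 * (ν i / c.κ i *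
      ((x i).ofLp ⬝ᵥ c.P i *ᵥ (Network.closedLoop hX K x i).ofLp))
      ≤ -(ν i * c.V i (x i)) + ν i * ∑' j, c.gain i j * c.V j (x j) := by
    intro i
    have hκi := (hdata i).2.2.1
    have h1 := (hdata i).dissipation (x i) (S.adv (fun j => x j) i)
    have h2 := rho_mul_adv_le hdata hmin (fun j => x j) i
    have h3 : Network.closedLoop hX K x i
        = S.subField i (x i) (S.adv (fun j => x j) i) (c.control i (x i)) := by
      rw [← hK]
      rfl
    rw [h3]
    have h4 := mul_le_mul_of_nonneg_left (h1.trans (add_le_add_right h2 _))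
      (div_nonneg (hν0 i) hκi.le)
    refine le_trans (le_of_eq (by ring)) (h4.trans (le_of_eq ?_))
    field_simp
  have h1 := hasSum_le hterm ((hB x (Network.closedLoop hX K x)).mul_left 2)
    (hνV.hasSum.neg.add hs.hasSum)
  have h2 : κlo * B x x ≤ ∑' i, ν i * c.V i (x i) := by
    refine hasSum_le (fun i => ?_) ((hB x x).mul_left κlo) hνV.hasSum
    have hκi := (hdata i).2.2.1
    change κlo * (ν i / c.κ i * c.V i (x i)) ≤ _
    rw [← mul_assoc]
    refine mul_le_mul_of_nonneg_right ?_ (hV0 i)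
    rw [← mul_div_assoc, div_le_iff₀ hκi, mul_comm]
    exact mul_le_mul_of_nonneg_left (hκ i) (hν0 i)
  have h3 := mul_le_mul_of_nonneg_left h2 (sub_nonneg.2 hq)
  linarith

end Design

/-- The control Lyapunov function in bilinear form, for a rate arbitrarily close to
`(1 - r) inf κ_i`. -/
theorem exists_quadratic_lyapunov {S : Network} {hX : S.MapsIntoX}
    {d : Experiment S} {c : Design S} (hdata : ∀ i, c.FromData d i) {K : S.X → S.U}
    (hK : ∀ x i, K x i = c.control i (x i)) (hv : LipschitzOnBalls (Network.closedLoop hX K))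
    {ζlo ζhi κlo : ℝ} (hζlo : 0 < ζlo) (hκlo : 0 < κlo)
    (hmin : ∀ i, ζlo ≤ lamMin (c.P i)) (hmax : ∀ i, lamMax (c.P i) ≤ ζhi)
    (hκ : ∀ i, κlo ≤ c.κ i) (hΘ : ColBounded c.Θ)
    (hr : spectralRadius ℂ (c.Ω hκlo hκ hΘ) < 1) {ε : ℝ} (hε : 0 < ε) :
    ∃ (μ : lp (fun _ : ℕ => ℝ) ∞) (κinf : ℝ) (B : S.X →L[ℝ] S.X →L[ℝ] ℝ),
      0 < ⨅ i, μ i ∧ 0 < κinf ∧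
      (1 - (spectralRadius ℂ (c.Ω hκlo hκ hΘ)).toReal) * (⨅ i, c.κ i) - ε ≤ κinf ∧
      0 < (⨅ i, μ i) * ⨅ i, lamMin (c.P i) ∧ 0 < (⨆ i, μ i) * ⨆ i, lamMax (c.P i) ∧
      (∀ x y, B x y = B y x) ∧
      (∀ x, HasSum (fun i => μ i * c.V i (x i)) (B x x)) ∧
      (∀ x, ((⨅ i, μ i) * ⨅ i, lamMin (c.P i)) * ‖x‖ ^ 2 ≤ B x x) ∧
      (∀ x, B x x ≤ ((⨆ i, μ i) * ⨆ i, lamMax (c.P i)) * ‖x‖ ^ 2) ∧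
      ∀ x, 2 * B x (Network.closedLoop hX K x) ≤ -κinf * B x x := by
  have hP : ∀ i, (c.P i).PosDef := fun i => (hdata i).2.1
  have hκpos : ∀ i, 0 < c.κ i := fun i => (hdata i).2.2.1
  have hminpos : ∀ i, 0 < lamMin (c.P i) := fun i => hζlo.trans_le (hmin i)
  have hlamle : ∀ i, lamMin (c.P i) ≤ lamMax (c.P i) := fun i => by
    obtain ⟨e, he⟩ := Design.exists_norm_eq_one_of_lamMin_pos (hminpos i)
    have := (Design.norm_sq_mul_le_V (hP i) le_rfl e).trans
      (Design.V_le_mul_norm_sq (hP i) le_rfl e)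
    simpa [he] using this
  have hbmin : BddBelow (Set.range fun i => lamMin (c.P i)) :=
    ⟨ζlo, by rintro _ ⟨i, rfl⟩; exact hmin i⟩
  have hbmax : BddAbove (Set.range fun i => lamMax (c.P i)) :=
    ⟨ζhi, by rintro _ ⟨i, rfl⟩; exact hmax i⟩
  have hbκ : BddBelow (Set.range c.κ) := ⟨κlo, by rintro _ ⟨i, rfl⟩; exact hκ i⟩
  set κI := ⨅ i, c.κ i with hκI
  have hκI0 : 0 < κI := hκlo.trans_le (le_ciInf hκ)
  set r := (spectralRadius ℂ (c.Ω hκlo hκ hΘ)).toReal with hrdef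
  have hr1 : r < 1 := by
    rw [hrdef, ← ENNReal.toReal_one]
    exact (ENNReal.toReal_lt_toReal hr.ne_top ENNReal.one_ne_top).2 hr
  -- `q` lies strictly between `r` and `1`, and `(q - r) inf κ_i ≤ ε`.
  set q := r + min ((1 - r) / 2) (ε / κI) with hq
  have hmin0 : 0 < min ((1 - r) / 2) (ε / κI) := lt_min (by linarith) (by positivity)
  have hrq : r < q := by linarith
  have hq1 : q < 1 := by
    have := min_le_left ((1 - r) / 2) (ε / κI)
    linarith
  have hqε : (q - r) * κI ≤ ε := by
    have := min_le_right ((1 - r) / 2) (ε / κI)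
    rw [← le_div_iff₀ hκI0]
    linarith
  obtain ⟨ν, C, hνC, hcol⟩ := exists_subinvariant_weight (c.colBounded_gain hκlo hκ hΘ)
    (Design.gain_nonneg hdata hminpos) ((ENNReal.lt_ofReal_iff_toReal_lt hr.ne_top).2 hrq)
  obtain ⟨κhi, hκhi⟩ := Design.exists_forall_kappa_le hdata hK hv hζlo hmin hmax
  have hκhi0 : 0 < κhi := (hκpos 0).trans_le (hκhi 0)
  have hν0 : ∀ i, 0 ≤ ν i := fun i => zero_le_one.trans (hνC i).1
  have hμlo : ∀ i, 1 / κhi ≤ ν i / c.κ i := fun i =>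
    div_le_div₀ (hν0 i) (hνC i).1 (hκpos i) (hκhi i)
  have hμhi : ∀ i, ν i / c.κ i ≤ C / κlo := fun i =>
    div_le_div₀ ((hν0 i).trans (hνC i).2) (hνC i).2 hκlo (hκ i)
  have hμ0 : ∀ i, 0 ≤ ν i / c.κ i := fun i => div_nonneg (hν0 i) (hκpos i).le
  have hμabs : ∀ i, |ν i / c.κ i| ≤ C / κlo := fun i => by
    rw [abs_of_nonneg (hμ0 i)]
    exact hμhi i
  let μ : lp (fun _ : ℕ => ℝ) ∞ :=
    ⟨fun i => ν i / c.κ i, memℓp_infty ⟨C / κlo, by rintro _ ⟨i, rfl⟩; exact hμabs i⟩⟩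
  have hμi : ∀ i, μ i = ν i / c.κ i := fun i => rfl
  have hbμ : BddBelow (Set.range fun i => μ i) := ⟨1 / κhi, by rintro _ ⟨i, rfl⟩; exact hμlo i⟩
  have hbμ' : BddAbove (Set.range fun i => μ i) := ⟨C / κlo, by rintro _ ⟨i, rfl⟩; exact hμhi i⟩
  have hI : 0 < ⨅ i, μ i := (by positivity : 0 < 1 / κhi).trans_le (le_ciInf hμlo)
  have hS : 0 < ⨆ i, μ i := hI.trans_le ((ciInf_le hbμ 0).trans (le_ciSup hbμ' 0))
  have hlI : 0 < ⨅ i, lamMin (c.P i) := hζlo.trans_le (le_ciInf hmin)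
  have hlS : 0 < ⨆ i, lamMax (c.P i) :=
    (hminpos 0).trans_le ((hlamle 0).trans (le_ciSup hbmax 0))
  obtain ⟨B, hBsymm, hB⟩ := exists_weightedForm hP hmax
    ((hminpos 0).le.trans ((hlamle 0).trans (hmax 0))) hμabs
  have hBV : ∀ x : S.X, HasSum (fun i => μ i * c.V i (x i)) (B x x) := fun x => hB x x
  refine ⟨μ, (1 - q) * κI, B, hI, mul_pos (by linarith) hκI0, by linarith, mul_pos hI hlI,
    mul_pos hS hlS, hBsymm, hBV, fun x => ?_, fun x => ?_,
    fun x => Design.weightedForm_decay hdata hK hminpos hν0 (fun i => (hνC i).2) hmax hq1.le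
      (fun i => ciInf_le hbκ i) hcol hB x⟩
  · refine hasSum_le (fun i => ?_) ((hasSum_norm_sq_lp_two x).mul_left _) (hBV x)
    rw [mul_assoc]
    exact mul_le_mul (ciInf_le hbμ i) (Design.norm_sq_mul_le_V (hP i) (ciInf_le hbmin i) (x i))
      (by positivity) (hμ0 i)
  · refine hasSum_le (fun i => ?_) (hBV x) ((hasSum_norm_sq_lp_two x).mul_left _)
    rw [mul_assoc]
    exact mul_le_mul (le_ciSup hbμ' i) (Design.V_le_mul_norm_sq (hP i) (le_ciSup hbmax i) (x i))
      (Design.V_nonneg (hP i) _) hS.le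

theorem theorem4 (S : Network) (hLip : S.UniformlyLipschitz) (hX : S.MapsIntoX)
    (d : Experiment S) (c : Design S) (hdata : ∀ i, c.FromData d i)
    (K : S.X → S.U) (hK : ∀ x i, K x i = c.control i (x i)) (hadm : Network.Admissible K)
    (ζlo ζhi κlo ρhi : ℝ) (hζlo : 0 < ζlo) (hκlo : 0 < κlo)
    (hmin : ∀ i, ζlo ≤ lamMin (c.P i)) (hmax : ∀ i, lamMax (c.P i) ≤ ζhi)
    (hκ : ∀ i, κlo ≤ c.κ i) (hρ : ∀ i, c.ρ i ≤ ρhi)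
    (hΘ : ColBounded c.Θ) (hr : spectralRadius ℂ (c.Ω hκlo hκ hΘ) < 1) :
    (∀ ε : ℝ, 0 < ε → ∃ (μ : lp (fun _ : ℕ => ℝ) ∞) (κinf : ℝ),
      0 < ⨅ i, μ i ∧ 0 < κinf ∧
      (1 - (spectralRadius ℂ (c.Ω hκlo hκ hΘ)).toReal) * (⨅ i, c.κ i) - ε ≤ κinf ∧
      (∀ x : S.X, Summable fun i => μ i * c.V i (x i)) ∧
      IsCLF (Network.closedLoop hX K) (fun x => ∑' i, μ i * c.V i (x i))
        ((⨅ i, μ i) * ⨅ i, lamMin (c.P i)) ((⨆ i, μ i) * ⨆ i, lamMax (c.P i)) κinf) ∧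
    IsUGAS (Network.closedLoop hX K) := by
  have hv := Network.lipschitzOnBalls_closedLoop hLip hX hadm
  refine ⟨fun ε hε => ?_, ?_⟩
  · obtain ⟨μ, κinf, B, hμ, hκinf, hrate, hlo, hhi, hsymm, hsum, hBlo, hBhi, hdec⟩ :=
      exists_quadratic_lyapunov hdata hK hv hζlo hκlo hmin hmax hκ hΘ hr hε
    refine ⟨μ, κinf, hμ, hκinf, hrate, fun x => (hsum x).summable, ?_⟩
    have hV : (fun x : S.X => ∑' i, μ i * c.V i (x i)) = fun x => B x x :=
      funext fun x => (hsum x).tsum_eq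
    rw [hV]
    exact isCLF_of_quadratic hv hsymm hlo hhi hκinf hBlo hBhi hdec
  · obtain ⟨μ, κinf, B, -, hκinf, -, hlo, hhi, hsymm, -, hBlo, hBhi, hdec⟩ :=
      exists_quadratic_lyapunov hdata hK hv hζlo hκlo hmin hmax hκ hΘ hr one_pos
    exact isUGAS_of_quadratic hv hsymm hlo hhi hκinf hBlo hBhi hdec
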